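/- **Theorem 3.** For $f\in L^p(\mathbb R^d)$ let $\operatorname{supp}\hat f$ be the support of the tempered distribution $\hat f$, where $\hat f(\omega)=\int f(x)e^{-i x\cdot\omega}\,dx$ for integrable $f$. In what follows $d\ge 1$ is an integer, $1\le p\le\infty$, and $a_1,\dots,a_d,b_1,\dots,b_d>0$. (i) There is an absolute constant $C>0$ such that the following holds for all $d$, $p$, $a_k$, $b_k$ and all $\gamma>0$. Let $J\subset\mathbb R^d$ be a parallelepiped with sides of length $b_1,\dots,b_d$ parallel to the coordinate axes, let $\Pi$ be a parallelepiped with sides of length $a_1,\dots,a_d$ parallel to the coordinate axes, and let $E\subset\mathbb R^d$ be a measurable set with $|E\cap(\Pi+x)|\ge\gamma|\Pi|$ for every $x\in\mathbb R^d$. If $f\in L^p(\mathbb R^d)$ and $\operatorname{supp}\hat f\subset J$, then $$\|f\|_{L^p(E)}\ \ge\ \left(\frac{\gamma}{C^d}\right)^{C\left(d+\sum_{k=1}^d a_kb_k\right)}\|f\|_{L^p(\mathbb R^d)}.$$ (ii) When $\sum_k a_kb_k$ is not small, this estimate is optimal except for the constant $C$: there is an absolute constant $c>0$ such that for all $d$,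 $p$, $a_k$, $b_k$ with $\sum_{k=1}^d a_kb_k\ge\max(d,1/c)$, all $\gamma\in(0,1]$ and every parallelepiped $J$ with sides of length $b_1,\dots,b_d$ parallel to the coordinate axes, there exist a measurable set $E\subset\mathbb R^d$ with $|E\cap(\Pi+x)|\ge\gamma|\Pi|$ for every $x\in\mathbb R^d$, where $\Pi=[0,a_1]\times\dots\times[0,a_d]$, and a function $0\ne f\in L^p(\mathbb R^d)$ with $\operatorname{supp}\hat f\subset J$, such that $$\|f\|_{L^p(E)}\ \le\ \left(\frac{\gamma}{c^d}\right)^{c\left(d+\sum_{k=1}^d a_kb_k\right)}\|f\|_{L^p(\mathbb R^d)}.$$ -/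

import Mathlib

open MeasureTheory
open scoped ENNReal FourierTransform SchwartzMap

noncomputable section

/-- The closed parallelepiped in `ℝ^d` with edges parallel to the coordinate axes, lower corner `x`
and side lengths `s 0, …, s (d - 1)`. As `x` varies, these are all the translates of one such
parallelepiped. -/
def axisBox {d : ℕ} (x : EuclideanSpace ℝ (Fin d)) (s : Fin d → ℝ) :
    Set (EuclideanSpace ℝ (Fin d)) :=
  {y | ∀ k, x k ≤ y k ∧ y k ≤ x k + s k}

/-- `E` meets every translate of a parallelepiped `Π` with side lengths `a k`, parallel to the
coordinate axes, in measure at least `γ |Π|`. -/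
def MeetsAllBoxes {d : ℕ} (E : Set (EuclideanSpace ℝ (Fin d))) (a : Fin d → ℝ) (γ : ℝ) : Prop :=
  ∀ x : EuclideanSpace ℝ (Fin d),
    ENNReal.ofReal γ * volume (axisBox x a) ≤ volume (E ∩ axisBox x a)

/-- The support of the Fourier transform of `f ∈ L^p(ℝ^d)`, which is a tempered distribution, for
the normalization `f̂ ω = ∫ f x * exp (-i ⟪x, ω⟫) dx`. Mathlib's `𝓕` is normalized with
`exp (-2 π i ⟪x, ξ⟫)`, so that `ω = 2 π ξ`. -/
def fourierSupport {d : ℕ} {p : ℝ≥0∞} [Fact (1 ≤ p)]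
    (f : Lp ℂ p (volume : Measure (EuclideanSpace ℝ (Fin d)))) :
    Set (EuclideanSpace ℝ (Fin d)) :=
  {ω | (2 * Real.pi)⁻¹ • ω ∈
    Distribution.dsupport (𝓕 (Lp.toTemperedDistribution f) : 𝓢'(EuclideanSpace ℝ (Fin d), ℂ))}

end

/-! A function `f ∈ L^p` whose spectrum lies in a box is not concentrated off a set `E` that meets
every translate of another box `Π` in measure at least `γ |Π|`, with a bound that is a power of
`γ / C ^ d`; the size of the exponent cannot be improved.

**Lower bound.** Let `X` be a smooth cutoff equal to `1` near the spectral box. Then `f` agrees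
almost everywhere with `F x = ∫ f t * K (x - t) dt`, where `K = 𝓕⁻ X` is a product of entire
functions of exponential type (`ae_eq_integral_mul_fourierInv`, which rests on the fact that a
tempered distribution kills every Schwartz function supported off its support). On complex
neighbourhoods of size `a k` in the `k`-th variable the modulated kernel is dominated by an
integrable function `w` whose mass is exponential in `d + ∑ a k * b k`
(`norm_mul_cutoffKernel_le`, `prod_kernelGrowth_mul_pi_le`).

Let `x` be a point where `(‖f‖ * w) x` is at most `2 ∫ w` times `‖F x‖`. Restricted to a segment
from `x` into the box based at `x`, the function `F` is entire up to a unimodular factor, and its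
interpolation polynomial at `m + 1` nodes of the segment predicts the value `F x` with relative
error `1 / 2` once `2 ^ m` exceeds `2 ∫ w`: this is Hermite's remainder estimate, applied under
the integral sign (`norm_sub_sum_basis_mul_le`, `norm_le_sum_basis_add_half`). If `F` were very
small on a large part of `E ∩ (x + Π)`, then some segment would meet that part in a set of length
`≳ γ ^ 2 / d` (`exists_segment_of_le_volume`), which contains well separated nodes; as the
Lagrange coefficients of such nodes sum to at most `(C d / γ ^ 2) ^ m`, this would contradict the
prediction. Hence `‖F‖` is at least about `(γ ^ 2 / (C d)) ^ m * ‖F x‖` on a part of `E ∩ (x + Π)`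
of measure `γ |Π| / 2` (`le_volume_setOf_mul_norm_le`). At the other points `F` is bounded by the
average `‖f‖ * w / (2 ∫ w)`, whose `L^p` norm is at most half that of `f` by Young's inequality,
so they do not matter. Averaging over `x` finishes the proof (`mul_lintegral_rpow_le`,
`mul_eLpNorm_le_of_local`).

**Sharpness.** Take `f x = sin (π (∑ s k * x k + θ)) ^ n * g x`, where `g` is a Schwartz function
with spectrum in a small box, `n` is proportional to `∑ a k * b k`, and `s k` is proportional to
`b k / n`, so that the spectrum of `f` still fits in the given box. Then `f` vanishes to order `n`
on parallel hyperplanes, and `E` is a union of slabs around them, of half-width about `4 ^ d * γ`.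
The linear form `∑ s k * y k` varies by between `2` and `4` over `Π`, so that each translate of
`Π` has a hyperplane through its middle half; a contraction argument compares the slab around it
with all the others (`volume_slab_le`, `meetsAllBoxes_slabs`). On `E` the sine is `O(4 ^ d * γ)`,
while for a suitable shift `θ` the norm of `f` is at least `2 ^ (-n - 1)` times that of `g`
(`exists_shift_le_eLpNorm`).
-/

/-! ### Extrapolation of entire functions from a set of nodes -/

/-- The error of the Lagrange interpolation at the point `0` of the Cauchy kernel
`x ↦ (z - x)⁻¹`. -/
theorem inv_sub_sum_basis_eval_zero {ι : Type*} [DecidableEq ι] {S : Finset ι} {v : ι → ℂ}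
    (hv : Set.InjOn v S) (hS : S.Nonempty) (hv0 : ∀ i ∈ S, v i ≠ 0) {z : ℂ} (hz : z ≠ 0)
    (hzv : ∀ i ∈ S, z ≠ v i) :
    z⁻¹ - ∑ i ∈ S, (Lagrange.basis S v i).eval 0 * (z - v i)⁻¹
      = z⁻¹ * ∏ i ∈ S, ((0 - v i) / (z - v i)) := by
  have partial_fractions : ∀ x : ℂ, (∀ i ∈ S, x ≠ v i) →
      ∑ i ∈ S, Lagrange.nodalWeight S v i * (x - v i)⁻¹
        = ((Lagrange.nodal S v).eval x)⁻¹ := by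
    intro x hx
    have h1 : ∑ i ∈ S, (Lagrange.basis S v i).eval x = 1 := by
      rw [← Polynomial.eval_finsetSum, Lagrange.sum_basis hv hS, Polynomial.eval_one]
    rw [Finset.sum_congr rfl (fun i hi => Lagrange.eval_basis_not_at_node hi (hx i hi)),
      ← Finset.mul_sum] at h1
    exact eq_inv_of_mul_eq_one_right h1
  have h0 : ∀ i ∈ S, (0 : ℂ) ≠ v i := fun i hi => (hv0 i hi).symm
  have hn0 : (Lagrange.nodal S v).eval 0 ≠ 0 := Lagrange.eval_nodal_not_at_node h0
  have key : ∑ i ∈ S, (Lagrange.basis S v i).eval 0 * (z - v i)⁻¹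
      = (Lagrange.nodal S v).eval 0 * z⁻¹ *
        (∑ i ∈ S, Lagrange.nodalWeight S v i * (0 - v i)⁻¹
          - ∑ i ∈ S, Lagrange.nodalWeight S v i * (z - v i)⁻¹) := by
    rw [← Finset.sum_sub_distrib, Finset.mul_sum]
    refine Finset.sum_congr rfl fun i hi => ?_
    rw [Lagrange.eval_basis_not_at_node hi (h0 i hi)]
    have h1 : z - v i ≠ 0 := sub_ne_zero.2 (hzv i hi)
    have h2 : 0 - v i ≠ 0 := sub_ne_zero.2 (h0 i hi)
    field_simp
    ring
  rw [key, partial_fractions 0 h0, partial_fractions z hzv, Finset.prod_div_distrib,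
    ← Lagrange.eval_nodal, ← Lagrange.eval_nodal]
  have hnz : (Lagrange.nodal S v).eval z ≠ 0 := Lagrange.eval_nodal_not_at_node hzv
  field_simp
  ring

/-- Hermite's remainder estimate at the point `0`: an entire function bounded by `M` on the circle
`|z| = 3` is recovered from its values at `m + 1` nodes in `(0, 1]` up to `M / 2 ^ (m + 1)`. -/
theorem norm_sub_sum_basis_mul_le {m : ℕ} {s : Fin (m + 1) → ℝ} (hs : Function.Injective s)
    (hs0 : ∀ i, 0 < s i) (hs1 : ∀ i, s i ≤ 1) {φ : ℂ → ℂ} (hφ : Differentiable ℂ φ) {M : ℝ}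
    (hM : ∀ z, ‖z‖ = 3 → ‖φ z‖ ≤ M) :
    ‖φ 0 - ∑ i, (Lagrange.basis Finset.univ (fun i => (s i : ℂ)) i).eval 0 * φ (s i)‖
      ≤ M / 2 ^ (m + 1) := by
  set c : Fin (m + 1) → ℂ :=
    fun i => (Lagrange.basis Finset.univ (fun i => (s i : ℂ)) i).eval 0 with hc
  have hM0 : 0 ≤ M := (norm_nonneg _).trans (hM 3 (by norm_num))
  have cauchy : ∀ w : ℂ, ‖w‖ < 3 → (∮ z in C(0, 3), (z - w)⁻¹ • φ z)
      = (2 * Real.pi * Complex.I : ℂ) • φ w := fun w hw =>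
    Complex.circleIntegral_sub_inv_smul_of_differentiable_on_off_countable
      (s := ∅) Set.countable_empty (by simpa using hw) hφ.continuous.continuousOn
      (fun x _ => hφ x)
  have hslt : ∀ i, ‖(s i : ℂ)‖ < 3 := fun i => by
    rw [Complex.norm_real, Real.norm_of_nonneg (hs0 i).le]; linarith [hs1 i]
  have hne : ∀ w : ℂ, ‖w‖ < 3 → ∀ z ∈ Metric.sphere (0 : ℂ) 3, z - w ≠ 0 := by
    intro w hw z hz h
    rw [sub_eq_zero] at h
    rw [mem_sphere_zero_iff_norm, h] at hz
    linarith
  have hci : ∀ w : ℂ, ‖w‖ < 3 → CircleIntegrable (fun z => (z - w)⁻¹ • φ z) 0 3 := by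
    intro w hw
    refine ContinuousOn.circleIntegrable (by norm_num) ?_
    refine ContinuousOn.smul (ContinuousOn.inv₀ (by fun_prop) (hne w hw)) hφ.continuous.continuousOn
  have hsum : (2 * Real.pi * Complex.I : ℂ)⁻¹ •
      (∮ z in C(0, 3), ((z - 0)⁻¹ • φ z - ∑ i, c i • ((z - (s i : ℂ))⁻¹ • φ z)))
      = φ 0 - ∑ i, c i * φ (s i) := by
    have hpi : (2 * Real.pi * Complex.I : ℂ) ≠ 0 := Complex.two_pi_I_ne_zero
    rw [circleIntegral.integral_sub (hci 0 (by simp)), circleIntegral.integral_fun_sum,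
      cauchy 0 (by simp)]
    · simp only [circleIntegral.integral_smul, cauchy _ (hslt _)]
      simp only [smul_eq_mul, mul_sub, Finset.mul_sum]
      congr 1
      · field_simp
      · refine Finset.sum_congr rfl fun i _ => ?_
        field_simp
    · exact fun i _ => (hci _ (hslt i)).const_smul
    · exact CircleIntegrable.fun_sum _ fun i _ => (hci _ (hslt i)).const_smul
  rw [← hsum]
  have hbound : ∀ z ∈ Metric.sphere (0 : ℂ) 3,
      ‖(z - 0)⁻¹ • φ z - ∑ i, c i • ((z - (s i : ℂ))⁻¹ • φ z)‖ ≤ 3⁻¹ * (M / 2 ^ (m + 1)) := by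
    intro z hz
    have hz3 : ‖z‖ = 3 := mem_sphere_zero_iff_norm.1 hz
    have hfac : (z - 0)⁻¹ • φ z - ∑ i, c i • ((z - (s i : ℂ))⁻¹ • φ z)
        = (z⁻¹ * ∏ i, ((0 - (s i : ℂ)) / (z - s i))) * φ z := by
      rw [← inv_sub_sum_basis_eval_zero (S := Finset.univ) (v := fun i => (s i : ℂ))
        (Complex.ofReal_injective.comp hs).injOn Finset.univ_nonempty
        (fun i _ => by exact_mod_cast (hs0 i).ne') (by rintro rfl; simp at hz3)
        (fun i _ => sub_ne_zero.1 (hne _ (hslt i) z hz)), sub_mul, Finset.sum_mul]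
      simp [smul_eq_mul, hc, mul_assoc]
    rw [hfac, norm_mul, norm_mul, norm_inv, hz3, norm_prod, mul_assoc]
    have hprod : ∏ i, ‖(0 - (s i : ℂ)) / (z - s i)‖ ≤ ∏ _i : Fin (m + 1), (2⁻¹ : ℝ) := by
      refine Finset.prod_le_prod (fun _ _ => norm_nonneg _) fun i _ => ?_
      have h1 : ‖(s i : ℂ)‖ ≤ 1 := by
        rw [Complex.norm_real, Real.norm_of_nonneg (hs0 i).le]; exact hs1 i
      have h2 : 2 ≤ ‖z - s i‖ := by
        have := norm_sub_norm_le z (s i : ℂ); linarith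
      rw [norm_div, zero_sub, norm_neg, div_le_iff₀ (by linarith)]
      linarith
    rw [Finset.prod_const, Finset.card_univ, Fintype.card_fin] at hprod
    calc 3⁻¹ * ((∏ i, ‖(0 - (s i : ℂ)) / (z - s i)‖) * ‖φ z‖)
        ≤ 3⁻¹ * ((2⁻¹ : ℝ) ^ (m + 1) * M) := by gcongr; exact hM z hz3
      _ = _ := by rw [inv_pow]; ring
  refine (circleIntegral.norm_two_pi_i_inv_smul_integral_le_of_norm_le_const (by norm_num)
    hbound).trans_eq ?_
  ring

theorem prod_erase_abs_natCast_sub (m i : ℕ) (hi : i ≤ m) :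
    ∏ j ∈ (Finset.range (m + 1)).erase i, |(i : ℝ) - j| = (i.factorial * (m - i).factorial : ℕ) := by
  induction m, hi using Nat.le_induction with
  | base =>
    rw [Finset.range_add_one, Finset.erase_insert Finset.notMem_range_self,
      ← Finset.prod_range_reflect, Nat.sub_self, Nat.factorial_zero, mul_one,
      ← Finset.prod_range_add_one_eq_factorial]
    push_cast
    refine Finset.prod_congr rfl fun j hj => ?_
    have hj' := Finset.mem_range.1 hj
    rw [Nat.cast_sub (by omega), Nat.cast_sub (by omega), abs_of_nonneg] <;> push_cast <;> linarith
  | succ m hm ih =>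
    rw [Finset.range_add_one, Finset.erase_insert_of_ne (by omega), Finset.prod_insert (by simp), ih,
      Nat.succ_sub hm, Nat.factorial_succ]
    have : |(i : ℝ) - ((m + 1 : ℕ) : ℝ)| = ((m - i).succ : ℕ) := by
      rw [abs_sub_comm, Nat.succ_eq_add_one, abs_of_nonneg]
      · push_cast [Nat.cast_sub hm]; ring
      · have : (i : ℝ) ≤ m := by exact_mod_cast hm
        push_cast; linarith
    rw [this]
    push_cast
    ring

theorem factorial_div_two_pow_le_prod_erase (m : ℕ) (i : Fin (m + 1)) :
    (m.factorial : ℝ) / 2 ^ m ≤ ∏ j ∈ Finset.univ.erase i, |((i : ℕ) : ℝ) - ((j : ℕ) : ℝ)| := by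
  have hi : (i : ℕ) ≤ m := Nat.lt_succ_iff.1 i.2
  have h1 : ∏ j ∈ Finset.univ.erase i, |((i : ℕ) : ℝ) - ((j : ℕ) : ℝ)|
      = ∏ j ∈ (Finset.range (m + 1)).erase i, |((i : ℕ) : ℝ) - j| := by
    refine Finset.prod_bij (fun j _ => (j : ℕ)) ?_ ?_ ?_ ?_
    · intro j hj
      simp only [Finset.mem_erase, Finset.mem_univ, and_true] at hj
      simpa [Finset.mem_erase, Fin.val_inj] using ⟨hj, by omega⟩
    · intro j _ k _ h
      exact Fin.ext h
    · intro j hj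
      simp only [Finset.mem_erase, Finset.mem_range] at hj
      exact ⟨⟨j, hj.2⟩, by simp [Fin.ext_iff, hj.1], rfl⟩
    · intros; rfl
  rw [h1, prod_erase_abs_natCast_sub m i hi, div_le_iff₀ (by positivity)]
  have h2 : m.factorial ≤ (i : ℕ).factorial * (m - i).factorial * 2 ^ m := by
    rw [← Nat.choose_mul_factorial_mul_factorial hi, mul_assoc, mul_comm]
    exact Nat.mul_le_mul_left _ (Nat.choose_le_two_pow _ _)
  exact_mod_cast h2

/-- The Lagrange basis polynomials of nodes in `(0, 1]` whose mutual distances are at least those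
of an arithmetic progression with step `η / (m + 1)` have a controlled absolute sum at `0`. -/
theorem sum_norm_basis_eval_zero_le {m : ℕ} {s : Fin (m + 1) → ℝ} (hs0 : ∀ i, 0 < s i)
    (hs1 : ∀ i, s i ≤ 1) {η : ℝ} (hη : 0 < η)
    (hsep : ∀ i j : Fin (m + 1),
      |((i : ℕ) : ℝ) - ((j : ℕ) : ℝ)| * (η / (m + 1)) ≤ |s i - s j|) :
    ∑ i, ‖(Lagrange.basis Finset.univ (fun i => (s i : ℂ)) i).eval 0‖ ≤ 3 * (12 / η) ^ m := by
  have hm : (0 : ℝ) < m + 1 := by positivity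
  have hterm : ∀ i, ‖(Lagrange.basis Finset.univ (fun i => (s i : ℂ)) i).eval 0‖
      ≤ 2 ^ m * ((m + 1) / η) ^ m / m.factorial := by
    intro i
    rw [Lagrange.basis, Polynomial.eval_prod, norm_prod]
    calc ∏ j ∈ Finset.univ.erase i,
          ‖(Lagrange.basisDivisor (s i : ℂ) (s j : ℂ)).eval 0‖
        ≤ ∏ j ∈ Finset.univ.erase i,
            (|((i : ℕ) : ℝ) - ((j : ℕ) : ℝ)|⁻¹ * ((m + 1) / η)) := by
          refine Finset.prod_le_prod (fun _ _ => norm_nonneg _) fun j hj => ?_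
          have hij : i ≠ j := (Finset.ne_of_mem_erase hj).symm
          have hpos : 0 < |((i : ℕ) : ℝ) - ((j : ℕ) : ℝ)| := by
            rw [abs_pos, sub_ne_zero]
            exact fun h => hij (Fin.ext (by exact_mod_cast h))
          have h1 : ‖(0 : ℂ) - s j‖ ≤ 1 := by
            rw [zero_sub, norm_neg, Complex.norm_real, Real.norm_of_nonneg (hs0 j).le]
            exact hs1 j
          have h2 : ‖(s i : ℂ) - s j‖ = |s i - s j| := by
            rw [← Complex.ofReal_sub, Complex.norm_real, Real.norm_eq_abs]
          simp only [Lagrange.basisDivisor, Polynomial.eval_mul, Polynomial.eval_C,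
            Polynomial.eval_sub, Polynomial.eval_X, norm_mul, norm_inv, h2]
          calc |s i - s j|⁻¹ * ‖(0 : ℂ) - s j‖
              ≤ (|((i : ℕ) : ℝ) - ((j : ℕ) : ℝ)| * (η / (m + 1)))⁻¹ * 1 := by
                gcongr; exact hsep i j
            _ = _ := by rw [mul_inv, inv_div, mul_one]
      _ = (∏ j ∈ Finset.univ.erase i, |((i : ℕ) : ℝ) - ((j : ℕ) : ℝ)|)⁻¹ * ((m + 1) / η) ^ m := by
          rw [Finset.prod_mul_distrib, Finset.prod_inv_distrib, Finset.prod_const,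
            Finset.card_erase_of_mem (Finset.mem_univ i), Finset.card_univ, Fintype.card_fin,
            Nat.add_sub_cancel]
      _ ≤ ((m.factorial : ℝ) / 2 ^ m)⁻¹ * ((m + 1) / η) ^ m := by
          gcongr
          exact factorial_div_two_pow_le_prod_erase m i
      _ = _ := by rw [inv_div]; ring
  have hexp : ((m : ℝ) + 1) ^ m * (m + 1) / ((m + 1) * m.factorial) ≤ 3 ^ (m + 1) := by
    have h1 := Real.pow_div_factorial_le_exp ((m : ℝ) + 1) hm.le (m + 1)
    rw [Nat.factorial_succ, pow_succ] at h1
    push_cast at h1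
    refine h1.trans ?_
    calc Real.exp (m + 1) = Real.exp 1 ^ (m + 1) := by rw [← Real.exp_nat_mul]; simp
      _ ≤ _ := by gcongr; exact Real.exp_one_lt_three.le
  rw [mul_comm ((m : ℝ) + 1) (m.factorial : ℝ), mul_div_mul_right _ _ hm.ne'] at hexp
  have htwo : (m : ℝ) + 1 ≤ 2 ^ m := by exact_mod_cast Nat.lt_two_pow_self (n := m)
  calc ∑ i, ‖(Lagrange.basis Finset.univ (fun i => (s i : ℂ)) i).eval 0‖
      ≤ ∑ _i : Fin (m + 1), 2 ^ m * (((m : ℝ) + 1) / η) ^ m / m.factorial :=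
        Finset.sum_le_sum fun i _ => hterm i
    _ = (m + 1) * (2 ^ m * ((((m : ℝ) + 1) ^ m / m.factorial) / η ^ m)) := by
        rw [Finset.sum_const, Finset.card_univ, Fintype.card_fin, nsmul_eq_mul, div_pow]
        push_cast
        ring
    _ ≤ 2 ^ m * (2 ^ m * (3 ^ (m + 1) / η ^ m)) := by gcongr
    _ = 3 * (12 / η) ^ m := by
        rw [div_pow, show (12 : ℝ) = 2 * 2 * 3 by norm_num, mul_pow, mul_pow]
        ring

/-- A set of reals of measure larger than `m h` contains `m + 1` points with gaps at least `h`. -/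
theorem exists_separated_nodes {m : ℕ} {T : Set ℝ} {h : ℝ} (hh : 0 ≤ h) (hTb : BddBelow T)
    (hT : ENNReal.ofReal (m * h) < volume T) :
    ∃ s : Fin (m + 1) → ℝ, (∀ i, s i ∈ T) ∧
      ∀ i j : Fin (m + 1), i ≤ j → (((j : ℕ) : ℝ) - ((i : ℕ) : ℝ)) * h ≤ s j - s i := by
  induction m generalizing T with
  | zero =>
    obtain ⟨t, ht⟩ : T.Nonempty := by
      rw [Set.nonempty_iff_ne_empty]
      rintro rfl
      simp at hT
    refine ⟨fun _ => t, fun _ => ht, fun i j _ => ?_⟩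
    simp [Fin.eq_zero i, Fin.eq_zero j]
  | succ m ih =>
    have hne : T.Nonempty := by
      rw [Set.nonempty_iff_ne_empty]
      rintro rfl
      simp at hT
    -- The first node is taken so close to the infimum that little measure lies below it.
    obtain ⟨δ, hδ, hδT⟩ : ∃ δ : ℝ, 0 < δ ∧ ENNReal.ofReal ((m + 1 : ℕ) * h + δ) < volume T := by
      have hc : Filter.Tendsto (fun δ : ℝ => ENNReal.ofReal ((m + 1 : ℕ) * h + δ))
          (nhdsWithin 0 (Set.Ioi 0)) (nhds (ENNReal.ofReal ((m + 1 : ℕ) * h + 0))) :=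
        ((ENNReal.continuous_ofReal.comp (by fun_prop)).tendsto 0).mono_left nhdsWithin_le_nhds
      rw [add_zero] at hc
      obtain ⟨δ, h1, h2⟩ := ((hc.eventually_lt_const hT).and self_mem_nhdsWithin).exists
      exact ⟨δ, h2, h1⟩
    obtain ⟨t, htT, ht⟩ := exists_lt_of_csInf_lt hne (lt_add_of_pos_right (sInf T) hδ)
    set T' := T ∩ Set.Ici (t + h) with hT'
    have hcover : T ⊆ Set.Icc (sInf T) (t + h) ∪ T' := by
      intro x hx
      rcases le_total x (t + h) with hxt | hxt
      · exact Or.inl ⟨csInf_le hTb hx, hxt⟩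
      · exact Or.inr ⟨hx, hxt⟩
    have hT'vol : ENNReal.ofReal (m * h) < volume T' := by
      by_contra! hle
      refine absurd hδT (not_lt.2 ?_)
      calc volume T ≤ volume (Set.Icc (sInf T) (t + h)) + volume T' :=
            (measure_mono hcover).trans (measure_union_le _ _)
        _ ≤ ENNReal.ofReal (δ + h) + ENNReal.ofReal (m * h) := by
            rw [Real.volume_Icc]
            gcongr
            linarith
        _ = ENNReal.ofReal ((m + 1 : ℕ) * h + δ) := by
            rw [← ENNReal.ofReal_add (by positivity) (by positivity)]
            congr 1
            push_cast
            ring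
    obtain ⟨s, hsT, hs⟩ := ih (hTb.mono Set.inter_subset_left) hT'vol
    refine ⟨Fin.cons t s, fun i => ?_, fun i j hij => ?_⟩
    · refine Fin.cases ?_ (fun i => ?_) i
      · exact htT
      · exact (hsT i).1
    · induction i using Fin.cases with
      | zero =>
        induction j using Fin.cases with
        | zero => simp
        | succ j =>
          have h1 := hs 0 j (Fin.zero_le _)
          have h2 : t + h ≤ s 0 := (hsT 0).2
          simp only [Fin.cons_succ, Fin.cons_zero, Fin.val_succ, Fin.val_zero] at h1 ⊢
          push_cast at h1 ⊢
          linarith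
      | succ i =>
        induction j using Fin.cases with
        | zero => exact absurd hij (by simp)
        | succ j =>
          have h1 := hs i j (Fin.succ_le_succ_iff.1 hij)
          simp only [Fin.cons_succ, Fin.val_succ]
          push_cast
          linarith

/-! ### Boxes -/

theorem axisBox_eq_preimage {d : ℕ} (x : EuclideanSpace ℝ (Fin d)) (s : Fin d → ℝ) :
    axisBox x s = WithLp.ofLp ⁻¹' Set.Icc (fun k => x k) (fun k => x k + s k) := by
  ext y
  simp [axisBox, Pi.le_def, forall_and]

theorem isClosed_axisBox {d : ℕ} (x : EuclideanSpace ℝ (Fin d)) (s : Fin d → ℝ) :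
    IsClosed (axisBox x s) := by
  rw [axisBox_eq_preimage]
  exact isClosed_Icc.preimage (PiLp.continuous_ofLp _ _)

theorem measurableSet_axisBox {d : ℕ} (x : EuclideanSpace ℝ (Fin d)) (s : Fin d → ℝ) :
    MeasurableSet (axisBox x s) := (isClosed_axisBox x s).measurableSet

theorem volume_axisBox {d : ℕ} (x : EuclideanSpace ℝ (Fin d)) (s : Fin d → ℝ) :
    volume (axisBox x s) = ∏ k, ENNReal.ofReal (s k) := by
  rw [axisBox_eq_preimage, (PiLp.volume_preserving_ofLp (Fin d)).measure_preimage
    measurableSet_Icc.nullMeasurableSet, Real.volume_Icc_pi]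
  simp

theorem volume_axisBox_ne_top {d : ℕ} (x : EuclideanSpace ℝ (Fin d)) (s : Fin d → ℝ) :
    volume (axisBox x s) ≠ ∞ := by
  rw [volume_axisBox]
  exact ENNReal.prod_ne_top fun _ _ => ENNReal.ofReal_ne_top

theorem volume_axisBox_ne_zero {d : ℕ} (x : EuclideanSpace ℝ (Fin d)) {s : Fin d → ℝ}
    (hs : ∀ k, 0 < s k) : volume (axisBox x s) ≠ 0 := by
  rw [volume_axisBox]
  exact Finset.prod_ne_zero_iff.2 fun k _ => by simpa using hs k

theorem homothety_mem_axisBox {d : ℕ} {x z y : EuclideanSpace ℝ (Fin d)} {a : Fin d → ℝ}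
    (hz : z ∈ axisBox x a) (hy : y ∈ axisBox x a) {t : ℝ} (ht0 : 0 ≤ t) (ht1 : t ≤ 1) :
    AffineMap.homothety z t y ∈ axisBox x a := by
  intro k
  simp only [AffineMap.homothety_apply, vsub_eq_sub, vadd_eq_add, PiLp.add_apply, PiLp.smul_apply,
    PiLp.sub_apply, smul_eq_mul]
  have h1 := hz k
  have h2 := hy k
  constructor <;> nlinarith

/-- A subset `A` of a box of relative measure at least `θ` meets some segment from the corner `x₀`
to a point of the box in relative length at least `θ ^ 2 / (4 d)`. The reason is that the box shrunk
towards `x₀` by a factor `t` close to `1` still contains half of `A`; averaging over these `t` and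
over the endpoint of the segment gives the claim. -/
theorem exists_segment_of_le_volume {d : ℕ} (hd : 1 ≤ d) {a : Fin d → ℝ} (ha : ∀ k, 0 < a k)
    {x₀ : EuclideanSpace ℝ (Fin d)} {A : Set (EuclideanSpace ℝ (Fin d))} (hA : MeasurableSet A)
    (hAQ : A ⊆ axisBox x₀ a) {θ : ℝ} (hθ0 : 0 < θ) (hθ1 : θ ≤ 1)
    (h : ENNReal.ofReal θ * volume (axisBox x₀ a) ≤ volume A) :
    ∃ y ∈ axisBox x₀ a,
      ENNReal.ofReal (θ ^ 2 / (4 * d)) ≤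
        volume {t : ℝ | t ∈ Set.Ioc (0 : ℝ) 1 ∧ AffineMap.homothety x₀ t y ∈ A} := by
  have hd' : (1 : ℝ) ≤ d := by exact_mod_cast hd
  set Q := axisBox x₀ a with hQ
  have hQm : MeasurableSet Q := measurableSet_axisBox _ _
  have hQtop : volume Q ≠ ∞ := volume_axisBox_ne_top _ _
  have hQ0 : volume Q ≠ 0 := volume_axisBox_ne_zero _ ha
  have hx₀ : x₀ ∈ Q := fun k => ⟨le_rfl, by linarith [ha k]⟩
  set M : Set (EuclideanSpace ℝ (Fin d) × ℝ) :=
    {q | q.1 ∈ Q ∧ q.2 ∈ Set.Ioc (0 : ℝ) 1 ∧ AffineMap.homothety x₀ q.2 q.1 ∈ A} with hMdef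
  have hMm : MeasurableSet M := by
    refine (measurable_fst hQm).inter ((measurable_snd measurableSet_Ioc).inter ?_)
    have : Measurable fun q : EuclideanSpace ℝ (Fin d) × ℝ => AffineMap.homothety x₀ q.2 q.1 := by
      simp only [AffineMap.homothety_apply, vsub_eq_sub, vadd_eq_add]
      fun_prop
    exact this hA
  have hsection : ∀ t ∈ Set.Ioc (1 - θ / (2 * d)) 1,
      ENNReal.ofReal (θ / 2) * volume Q ≤ volume ((fun y => (y, t)) ⁻¹' M) := by
    intro t ht
    have hdiv : θ / (2 * d) ≤ 1 / 2 := by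
      rw [div_le_div_iff₀ (by positivity) (by norm_num)]; nlinarith
    have ht0 : 0 < t := by linarith [ht.1]
    have htd : 1 - θ / 2 ≤ t ^ d := by
      have h1 := one_add_mul_le_pow (a := t - 1) (by linarith) d
      have h2 : (d : ℝ) * (θ / (2 * d)) = θ / 2 := by field_simp
      have h3 : (d : ℝ) * (1 - t) ≤ d * (θ / (2 * d)) := by
        gcongr; linarith [ht.1]
      rw [add_sub_cancel] at h1
      nlinarith
    have htd1 : t ^ d ≤ 1 := pow_le_one₀ ht0.le ht.2
    set Qt := AffineMap.homothety x₀ t '' Q with hQt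
    have hvolQt : volume Qt = ENNReal.ofReal (t ^ d) * volume Q := by
      rw [hQt, Measure.addHaar_image_homothety, finrank_euclideanSpace_fin,
        abs_of_nonneg (by positivity)]
    have hsub : A ∩ Qt ⊆ AffineMap.homothety x₀ t '' ((fun y => (y, t)) ⁻¹' M) := by
      rintro _ ⟨hyA, y, hyQ, rfl⟩
      exact ⟨y, ⟨hyQ, ⟨ht0, ht.2⟩, hyA⟩, rfl⟩
    have h1 : volume (A ∩ Qt) ≤ volume ((fun y => (y, t)) ⁻¹' M) := by
      refine (measure_mono hsub).trans ?_
      rw [Measure.addHaar_image_homothety, finrank_euclideanSpace_fin,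
        abs_of_nonneg (by positivity)]
      exact mul_le_of_le_one_left zero_le (by rw [ENNReal.ofReal_le_one]; exact htd1)
    refine le_trans ?_ h1
    have hQtQ : Qt ⊆ Q := by
      rintro _ ⟨y, hy, rfl⟩
      exact homothety_mem_axisBox hx₀ hy ht0.le ht.2
    have hQtm : NullMeasurableSet Qt volume := by
      have : IsCompact Q := by
        rw [hQ, axisBox_eq_preimage]
        exact (PiLp.homeomorph 2 (fun _ : Fin d => ℝ)).isCompact_preimage.2 isCompact_Icc
      exact (this.image (AffineMap.homothety_continuous x₀ t)).isClosed.measurableSet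
        |>.nullMeasurableSet
    have h2 : volume A ≤ volume (A ∩ Qt) + volume (Q \ Qt) := by
      refine (measure_mono (t := (A ∩ Qt) ∪ (Q \ Qt)) ?_).trans (measure_union_le _ _)
      intro y hy
      by_cases hyt : y ∈ Qt
      · exact Or.inl ⟨hy, hyt⟩
      · exact Or.inr ⟨hAQ hy, hyt⟩
    have h3 : volume (Q \ Qt) ≤ ENNReal.ofReal (θ / 2) * volume Q := by
      rw [measure_sdiff hQtQ hQtm (measure_ne_top_of_subset hQtQ hQtop), hvolQt]
      rw [tsub_le_iff_right, ← add_mul, ← ENNReal.ofReal_add (by positivity) (by positivity)]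
      refine le_mul_of_one_le_left zero_le ?_
      rw [ENNReal.one_le_ofReal]
      linarith
    have h4 : ENNReal.ofReal (θ / 2) * volume Q + ENNReal.ofReal (θ / 2) * volume Q
        ≤ volume (A ∩ Qt) + ENNReal.ofReal (θ / 2) * volume Q := by
      rw [← add_mul, ← ENNReal.ofReal_add (by positivity) (by positivity), add_halves]
      exact h.trans (h2.trans (by gcongr))
    exact (ENNReal.add_le_add_iff_right
      (ENNReal.mul_ne_top ENNReal.ofReal_ne_top hQtop)).1 h4
  have hlow : ENNReal.ofReal (θ ^ 2 / (4 * d)) * volume Q ≤ (volume.prod volume) M := by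
    rw [Measure.prod_apply_symm hMm]
    calc ENNReal.ofReal (θ ^ 2 / (4 * d)) * volume Q
        = ∫⁻ _t in Set.Ioc (1 - θ / (2 * d)) 1, ENNReal.ofReal (θ / 2) * volume Q := by
          rw [setLIntegral_const, Real.volume_Ioc, mul_right_comm,
            ← ENNReal.ofReal_mul (by positivity)]
          congr 2
          field_simp
          ring
      _ ≤ ∫⁻ t in Set.Ioc (1 - θ / (2 * d)) 1, volume ((fun y => (y, t)) ⁻¹' M) :=
          setLIntegral_mono' measurableSet_Ioc hsection
      _ ≤ _ := setLIntegral_le_lintegral _ _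
  have hmeas : Measurable fun y => volume (Prod.mk y ⁻¹' M) := measurable_measure_prodMk_left hMm
  obtain ⟨y, hyQ, hy⟩ := exists_setLAverage_le (f := fun y => volume (Prod.mk y ⁻¹' M))
    hQ0 hQm.nullMeasurableSet (by
      refine ((setLIntegral_le_lintegral _ _).trans_lt ?_).ne
      rw [← Measure.prod_apply hMm]
      refine (measure_mono (t := Q ×ˢ Set.Ioc (0 : ℝ) 1) fun q hq => ⟨hq.1, hq.2.1⟩).trans_lt ?_
      rw [Measure.prod_prod, Real.volume_Ioc]
      exact ENNReal.mul_lt_top hQtop.lt_top ENNReal.ofReal_lt_top)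
  refine ⟨y, hyQ, ?_⟩
  have hset : Prod.mk y ⁻¹' M
      = {t : ℝ | t ∈ Set.Ioc (0 : ℝ) 1 ∧ AffineMap.homothety x₀ t y ∈ A} := by
    ext t
    simp [hMdef, hyQ]
  rw [← hset]
  refine le_trans ?_ hy
  rw [setLAverage_eq, ENNReal.le_div_iff_mul_le (Or.inl hQ0) (Or.inl hQtop)]
  refine hlow.trans ?_
  rw [Measure.prod_apply hMm, ← lintegral_indicator hQm]
  refine lintegral_mono fun z => ?_
  by_cases hz : z ∈ Q
  · simp [hz]
  · have : Prod.mk z ⁻¹' M = ∅ := by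
      ext t; simp [hMdef, hz]
    simp [this]

/-! ### A kernel of exponential type on the line -/

/-- A smooth cutoff on the line, equal to `1` on `[-1, 1]` and supported in `[-2, 2]`. -/
noncomputable def cutoff : ContDiffBump (0 : ℝ) where
  rIn := 1
  rOut := 2
  rIn_pos := one_pos
  rIn_lt_rOut := one_lt_two

/-- The inverse Fourier transform of `cutoff`, extended to an entire function. -/
noncomputable def cutoffKernel (z : ℂ) : ℂ :=
  ∫ ξ : ℝ, (cutoff ξ : ℂ) * Complex.exp (2 * Real.pi * Complex.I * z * ξ)

theorem cutoff_eq_one {ξ : ℝ} (h : |ξ| ≤ 1) : cutoff ξ = 1 :=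
  cutoff.one_of_mem_closedBall (by simpa [cutoff] using h)

theorem cutoff_eq_zero {ξ : ℝ} (h : 2 ≤ |ξ|) : cutoff ξ = 0 :=
  cutoff.zero_of_le_dist (by simpa [cutoff] using h)

theorem norm_exp_mul_le {z : ℂ} {ξ : ℝ} (h : |ξ| ≤ 2) :
    ‖Complex.exp (2 * Real.pi * Complex.I * z * ξ)‖ ≤ Real.exp (4 * Real.pi * |z.im|) := by
  rw [Complex.norm_exp]
  apply Real.exp_le_exp.2
  have h1 : (2 * Real.pi * Complex.I * z * ξ : ℂ).re = 2 * Real.pi * (-(z.im * ξ)) := by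
    simp
    ring
  rw [h1]
  have h2 : -(z.im * ξ) ≤ |z.im| * 2 := by
    refine (neg_le_abs _).trans ?_
    rw [abs_mul]
    gcongr
  nlinarith [Real.pi_pos]

theorem differentiable_cutoffKernel : Differentiable ℂ cutoffKernel := by
  intro z₀
  have hcont : ∀ z : ℂ, Continuous fun ξ : ℝ =>
      (cutoff ξ : ℂ) * Complex.exp (2 * Real.pi * Complex.I * z * ξ) := fun z =>
    (Complex.continuous_ofReal.comp cutoff.continuous).mul (by fun_prop)
  have hsupp : HasCompactSupport fun ξ : ℝ => (cutoff ξ : ℂ) :=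
    cutoff.hasCompactSupport.comp_left (g := fun x : ℝ => (x : ℂ)) (by simp)
  have key := hasDerivAt_integral_of_dominated_loc_of_deriv_le (μ := (volume : Measure ℝ))
    (F := fun (z : ℂ) (ξ : ℝ) => (cutoff ξ : ℂ) * Complex.exp (2 * Real.pi * Complex.I * z * ξ))
    (F' := fun (z : ℂ) (ξ : ℝ) => (cutoff ξ : ℂ) *
      (Complex.exp (2 * Real.pi * Complex.I * z * ξ) * (2 * Real.pi * Complex.I * ξ)))
    (x₀ := z₀) (s := Metric.ball z₀ 1)
    (bound := fun ξ => cutoff ξ *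
      (Real.exp (4 * Real.pi * (‖z₀‖ + 1)) * (2 * Real.pi * 2))) (Metric.ball_mem_nhds z₀ one_pos)
    (Filter.Eventually.of_forall fun z => (hcont z).aestronglyMeasurable)
    ((hcont z₀).integrable_of_hasCompactSupport hsupp.mul_right)
    (((Complex.continuous_ofReal.comp cutoff.continuous).mul
      (by fun_prop)).aestronglyMeasurable)
    (Filter.Eventually.of_forall fun ξ z hz => ?_)
    ((cutoff.continuous.mul continuous_const).integrable_of_hasCompactSupport
      cutoff.hasCompactSupport.mul_right)
    (Filter.Eventually.of_forall fun ξ z _ => ?_)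
  · exact key.2.differentiableAt
  · rw [norm_mul, Complex.norm_real, Real.norm_of_nonneg cutoff.nonneg]
    rcases le_or_gt 2 |ξ| with h | h
    · simp [cutoff_eq_zero h]
    · refine mul_le_mul_of_nonneg_left ?_ cutoff.nonneg
      rw [norm_mul]
      gcongr
      · refine (norm_exp_mul_le h.le).trans (Real.exp_le_exp.2 ?_)
        gcongr
        refine (Complex.abs_im_le_norm z).trans ?_
        have := norm_sub_norm_le z z₀
        rw [Metric.mem_ball, dist_eq_norm] at hz
        linarith
      · simp [abs_of_pos Real.pi_pos]
        nlinarith [Real.pi_pos, h.le]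
  · refine HasDerivAt.const_mul _ (HasDerivAt.cexp ?_)
    have := ((hasDerivAt_id z).const_mul (2 * Real.pi * Complex.I : ℂ)).mul_const (ξ : ℂ)
    simpa using this

theorem norm_integral_mul_exp_le {u : ℝ → ℂ} (hu : Integrable u)
    (hsupp : ∀ ξ, 2 ≤ |ξ| → u ξ = 0) (z : ℂ) :
    ‖∫ ξ : ℝ, u ξ * Complex.exp (2 * Real.pi * Complex.I * z * ξ)‖
      ≤ (∫ ξ, ‖u ξ‖) * Real.exp (4 * Real.pi * |z.im|) := by
  rw [← integral_mul_const]
  refine norm_integral_le_of_norm_le (hu.norm.mul_const _) (Filter.Eventually.of_forall fun ξ => ?_)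
  rcases le_or_gt 2 |ξ| with h | h
  · simp [hsupp ξ h]
  · rw [norm_mul]
    gcongr
    exact norm_exp_mul_le h.le

/-- Integration by parts. -/
theorem mul_integral_mul_exp {u u' : ℝ → ℂ} (hu : ∀ ξ, HasDerivAt u (u' ξ) ξ)
    (hu' : Continuous u') (hsupp : HasCompactSupport u) (hsupp' : HasCompactSupport u') (z : ℂ) :
    (2 * Real.pi * Complex.I * z) *
        ∫ ξ : ℝ, u ξ * Complex.exp (2 * Real.pi * Complex.I * z * ξ)
      = -∫ ξ : ℝ, u' ξ * Complex.exp (2 * Real.pi * Complex.I * z * ξ) := by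
  have huc : Continuous u := continuous_iff_continuousAt.2 fun ξ => (hu ξ).continuousAt
  rw [← integral_mul_deriv_eq_deriv_mul_of_integrable (u := u) (u' := u')
    (v := fun ξ : ℝ => Complex.exp (2 * Real.pi * Complex.I * z * ξ))
    (v' := fun ξ : ℝ => (2 * Real.pi * Complex.I * z) *
      Complex.exp (2 * Real.pi * Complex.I * z * ξ)) (fun ξ _ => hu ξ) (fun ξ _ => ?_)
    ((huc.mul (by fun_prop)).integrable_of_hasCompactSupport hsupp.mul_right)
    ((hu'.mul (by fun_prop)).integrable_of_hasCompactSupport hsupp'.mul_right)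
    ((huc.mul (by fun_prop)).integrable_of_hasCompactSupport hsupp.mul_right),
    ← integral_const_mul]
  · congr 1
    ext ξ
    ring
  · have h1 : HasDerivAt (fun ξ : ℝ => (2 * Real.pi * Complex.I * z : ℂ) * ξ)
        (2 * Real.pi * Complex.I * z) ξ := by
      simpa using (Complex.ofRealCLM.hasDerivAt (x := ξ)).const_mul (2 * Real.pi * Complex.I * z)
    simpa [mul_comm] using h1.cexp

/-- The Paley–Wiener estimate for `cutoffKernel`: exponential growth in the imaginary direction
and quadratic decay in the real one. -/
theorem exists_norm_cutoffKernel_le : ∃ C : ℝ, 1 ≤ C ∧ ∀ z : ℂ,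
    ‖cutoffKernel z‖ * (1 + z.re ^ 2) ≤ C * Real.exp (4 * Real.pi * |z.im|) := by
  have hsmooth : ContDiff ℝ 2 (fun ξ : ℝ => (cutoff ξ : ℂ)) :=
    Complex.ofRealCLM.contDiff.comp cutoff.contDiff
  set u₀ : ℝ → ℂ := fun ξ => (cutoff ξ : ℂ) with hu₀
  have hs₀ : HasCompactSupport u₀ :=
    cutoff.hasCompactSupport.comp_left (g := fun x : ℝ => (x : ℂ)) (by simp)
  have hs₁ : HasCompactSupport (deriv u₀) := hs₀.deriv
  have hs₂ : HasCompactSupport (deriv (deriv u₀)) := hs₁.deriv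
  have hsmooth₁ : ContDiff ℝ 1 (deriv u₀) := by
    have : ContDiff ℝ (1 + 1) u₀ := by simpa [one_add_one_eq_two] using hsmooth
    exact (contDiff_succ_iff_deriv.1 this).2.2
  have hc₂ : Continuous (deriv (deriv u₀)) := hsmooth₁.continuous_deriv le_rfl
  have hd₀ : ∀ ξ, HasDerivAt u₀ (deriv u₀ ξ) ξ := fun ξ =>
    (hsmooth.differentiable (by norm_num) ξ).hasDerivAt
  have hd₁ : ∀ ξ, HasDerivAt (deriv u₀) (deriv (deriv u₀) ξ) ξ := fun ξ =>
    (hsmooth₁.differentiable (by norm_num) ξ).hasDerivAt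
  have htsupp : tsupport (deriv (deriv u₀)) ⊆ Metric.closedBall 0 2 := by
    refine (tsupport_deriv_subset).trans ((tsupport_deriv_subset).trans ?_)
    refine (tsupport_comp_subset Complex.ofReal_zero _).trans ?_
    rw [cutoff.tsupport_eq]
    rfl
  have hI₀ : Integrable u₀ := hsmooth.continuous.integrable_of_hasCompactSupport hs₀
  have hI₂ : Integrable (deriv (deriv u₀)) := hc₂.integrable_of_hasCompactSupport hs₂
  have hz₂ : ∀ ξ, 2 ≤ |ξ| → deriv (deriv u₀) ξ = 0 := by
    intro ξ hξ
    by_contra hne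
    -- A continuous function vanishing outside `[-2, 2]` vanishes at the end points as well.
    have hopen : IsOpen (Function.support (deriv (deriv u₀))) := hc₂.isOpen_support
    have hsub : Function.support (deriv (deriv u₀)) ⊆ interior (Metric.closedBall 0 2) :=
      interior_maximal ((subset_tsupport _).trans htsupp) hopen
    rw [interior_closedBall _ (by norm_num)] at hsub
    have := hsub hne
    rw [mem_ball_zero_iff, Real.norm_eq_abs] at this
    linarith
  set A := ∫ ξ, ‖u₀ ξ‖
  set B := ∫ ξ, ‖deriv (deriv u₀) ξ‖
  have hA : 0 ≤ A := integral_nonneg fun _ => norm_nonneg _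
  have hB : 0 ≤ B := integral_nonneg fun _ => norm_nonneg _
  refine ⟨1 + A + B, by linarith, fun z => ?_⟩
  have h0 : ‖cutoffKernel z‖ ≤ A * Real.exp (4 * Real.pi * |z.im|) :=
    norm_integral_mul_exp_le hI₀ (fun ξ hξ => by simp [hu₀, cutoff_eq_zero hξ]) z
  have h2 : ‖z ^ 2 * cutoffKernel z‖ ≤ B * Real.exp (4 * Real.pi * |z.im|) := by
    have e1 := mul_integral_mul_exp hd₀ hsmooth₁.continuous hs₀ hs₁ z
    have e2 := mul_integral_mul_exp hd₁ hc₂ hs₁ hs₂ z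
    have e3 : (2 * Real.pi * Complex.I * z) * ((2 * Real.pi * Complex.I * z) * cutoffKernel z)
        = ∫ ξ : ℝ, deriv (deriv u₀) ξ * Complex.exp (2 * Real.pi * Complex.I * z * ξ) := by
      rw [cutoffKernel, e1, mul_neg, e2, neg_neg]
    have e4 := norm_integral_mul_exp_le hI₂ hz₂ z
    rw [← e3] at e4
    have e5 : ‖(2 * Real.pi * Complex.I * z) * ((2 * Real.pi * Complex.I * z) * cutoffKernel z)‖
        = (2 * Real.pi) ^ 2 * ‖z ^ 2 * cutoffKernel z‖ := by
      simp only [norm_mul, norm_pow, Complex.norm_I, Complex.norm_real, Real.norm_eq_abs,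
        abs_of_pos Real.pi_pos, Complex.norm_ofNat]
      ring
    rw [e5] at e4
    refine le_trans (le_mul_of_one_le_left (norm_nonneg _) ?_) e4
    nlinarith [Real.pi_gt_three]
  have h3 : z.re ^ 2 ≤ ‖z ^ 2‖ := by
    rw [norm_pow, ← sq_abs]
    gcongr
    exact Complex.abs_re_le_norm z
  calc ‖cutoffKernel z‖ * (1 + z.re ^ 2)
      = ‖cutoffKernel z‖ + z.re ^ 2 * ‖cutoffKernel z‖ := by ring
    _ ≤ ‖cutoffKernel z‖ + ‖z ^ 2 * cutoffKernel z‖ := by rw [norm_mul]; gcongr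
    _ ≤ A * Real.exp (4 * Real.pi * |z.im|) + B * Real.exp (4 * Real.pi * |z.im|) :=
        add_le_add h0 h2
    _ ≤ _ := by nlinarith [Real.exp_pos (4 * Real.pi * |z.im|)]

/-! ### Tempered distributions vanish on test functions supported off their support -/

section Support

variable {V : Type*} [NormedAddCommGroup V] [NormedSpace ℝ V] [FiniteDimensional ℝ V]

open Distribution in
/-- A partition of unity splits a compactly supported test function into finitely many pieces, each
supported in an open set on which the distribution vanishes. -/
theorem TemperedDistribution.apply_eq_zero_of_hasCompactSupport (T : 𝓢'(V, ℂ)) (ψ : 𝓢(V, ℂ))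
    (hψ : HasCompactSupport ψ) (h : tsupport ψ ⊆ (dsupport T)ᶜ) : T ψ = 0 := by
  classical
  let ι := {a : Set V // IsVanishingOn T a ∧ IsOpen a}
  obtain ⟨f, hf⟩ := SmoothPartitionOfUnity.exists_isSubordinate (modelWithCornersSelf ℝ V)
    (isClosed_tsupport ψ) (fun i : ι => (i : Set V)) (fun i => i.2.2) (by
      rw [dsupport_compl_eq, Set.sUnion_eq_iUnion] at h
      exact h)
  have hfin : {i | (Function.support (f i) ∩ tsupport ψ).Nonempty}.Finite :=
    f.locallyFinite.finite_nonempty_inter_compact hψ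
  have hfsm : ∀ i, ContDiff ℝ (⊤ : ℕ∞) fun x => (f i x : ℂ) * ψ x := fun i =>
    (Complex.ofRealCLM.contDiff.comp (f i).contMDiff.contDiff).mul (ψ.smooth ⊤)
  let u : ι → 𝓢(V, ℂ) := fun i =>
    HasCompactSupport.toSchwartzMap (f := fun x => (f i x : ℂ) * ψ x) hψ.mul_left (hfsm i)
  have hu : ∀ i x, u i x = (f i x : ℂ) * ψ x := fun i x => rfl
  have hsum : ψ = ∑ i ∈ hfin.toFinset, u i := by
    ext x
    rw [sum_apply]
    simp only [hu, ← Finset.sum_mul]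
    by_cases hx : x ∈ tsupport ψ
    · have h1 : ∑ᶠ i, f i x = 1 := f.sum_eq_one hx
      rw [finsum_eq_sum_of_support_subset _ (s := hfin.toFinset) (fun i hi => by
        simp only [Set.Finite.coe_toFinset, Set.mem_ofPred_eq]
        exact ⟨x, hi, hx⟩)] at h1
      rw [← Complex.ofReal_sum, h1, Complex.ofReal_one, one_mul]
    · rw [image_eq_zero_of_notMem_tsupport hx, mul_zero]
  rw [hsum, map_sum]
  refine Finset.sum_eq_zero fun i _ => i.2.1 (u i) ?_
  refine (closure_mono fun x hx => ?_).trans (hf i)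
  rw [Function.mem_support, hu] at hx
  intro h0
  exact hx (by simp [h0])

/-- Cutting off a Schwartz function at radius `n + 1` approximates it in the Schwartz topology. -/
theorem SchwartzMap.exists_tendsto_hasCompactSupport (ψ : 𝓢(V, ℂ)) :
    ∃ u : ℕ → 𝓢(V, ℂ), (∀ n, HasCompactSupport (u n)) ∧ (∀ n, tsupport (u n) ⊆ tsupport ψ) ∧
      Filter.Tendsto u Filter.atTop (nhds ψ) := by
  let χ : ContDiffBump (0 : V) := ⟨1, 2, one_pos, one_lt_two⟩
  have hχs : HasCompactSupport fun x => (χ x : ℂ) :=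
    χ.hasCompactSupport.comp_left (g := fun x : ℝ => (x : ℂ)) (by simp)
  have hχc : ContDiff ℝ (⊤ : ℕ∞) fun x => (χ x : ℂ) := Complex.ofRealCLM.contDiff.comp χ.contDiff
  let X : 𝓢(V, ℂ) := hχs.toSchwartzMap hχc
  let L : ℕ → V →L[ℝ] V := fun n => ((n : ℝ) + 1)⁻¹ • ContinuousLinearMap.id ℝ V
  have hL : ∀ n, ‖L n‖ ≤ 1 := fun n => by
    refine (norm_smul_le (((n : ℝ) + 1)⁻¹) (ContinuousLinearMap.id ℝ V)).trans ?_
    have h1 : ‖((n : ℝ) + 1)⁻¹‖ ≤ 1 := by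
      rw [norm_inv, Real.norm_of_nonneg (by positivity)]
      exact inv_le_one_of_one_le₀ (by linarith [(Nat.cast_nonneg n : (0 : ℝ) ≤ n)])
    exact mul_le_one₀ h1 (norm_nonneg _) ContinuousLinearMap.norm_id_le
  have hLinj : ∀ n, Topology.IsClosedEmbedding (L n) := fun n =>
    (Homeomorph.smulOfNeZero ((n : ℝ) + 1)⁻¹ (by positivity)).isClosedEmbedding
  have hsupp : ∀ n, HasCompactSupport fun x => (χ (L n x) : ℂ) * ψ x := fun n =>
    (hχs.comp_isClosedEmbedding (hLinj n)).mul_right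
  have hsm : ∀ n, ContDiff ℝ (⊤ : ℕ∞) fun x => (χ (L n x) : ℂ) * ψ x := fun n =>
    (hχc.comp (L n).contDiff).mul (ψ.smooth ⊤)
  have hval : ∀ n x, (hsupp n).toSchwartzMap (hsm n) x = (χ (L n x) : ℂ) * ψ x := fun n x => rfl
  refine ⟨fun n => (hsupp n).toSchwartzMap (hsm n), fun n => hsupp n, fun n => ?_, ?_⟩
  · exact closure_mono fun x hx h0 => hx (by simp only [hval, h0, mul_zero])
  rw [(schwartz_withSeminorms ℝ V ℂ).tendsto_nhds]
  rintro ⟨k, l⟩ ε hε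
  let θ : V → ℂ := fun y => (χ y : ℂ) - 1
  have hθ : ContDiff ℝ (⊤ : ℕ∞) θ := hχc.sub contDiff_const
  have hθb : ∀ i, ∃ B, ∀ y, ‖iteratedFDeriv ℝ i θ y‖ ≤ B := by
    intro i
    refine ⟨SchwartzMap.seminorm ℝ 0 i X + 1, fun y => ?_⟩
    have h1 : iteratedFDeriv ℝ i θ y
        = iteratedFDeriv ℝ i X y - iteratedFDeriv ℝ i (fun _ : V => (1 : ℂ)) y :=
      iteratedFDeriv_sub_apply ((X.smooth i).contDiffAt) contDiffAt_const
    rw [h1]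
    refine (norm_sub_le _ _).trans (add_le_add (X.norm_iteratedFDeriv_le_seminorm ℝ i y) ?_)
    rcases Nat.eq_zero_or_pos i with rfl | hi
    · simp
    · rw [iteratedFDeriv_const_of_ne hi.ne']
      simp
  choose B hB using hθb
  set M := ∑ i ∈ Finset.range (l + 1), (l.choose i : ℝ) * B i *
    SchwartzMap.seminorm ℝ (k + 1) (l - i) ψ with hM
  have hB0 : ∀ i, 0 ≤ B i := fun i => (norm_nonneg _).trans (hB i 0)
  have hM0 : 0 ≤ M := Finset.sum_nonneg fun i _ =>
    mul_nonneg (mul_nonneg (Nat.cast_nonneg _) (hB0 i)) (apply_nonneg _ _)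
  have hlim : Filter.Tendsto (fun n : ℕ => M * (1 / ((n : ℝ) + 1))) Filter.atTop (nhds (M * 0)) :=
    tendsto_one_div_add_atTop_nhds_zero_nat.const_mul M
  rw [mul_zero] at hlim
  filter_upwards [hlim.eventually_lt_const hε] with n hn
  refine lt_of_le_of_lt ?_ hn
  refine SchwartzMap.seminorm_le_bound ℝ k l _ (by positivity) fun x => ?_
  have hcoe : ((((hsupp n).toSchwartzMap (hsm n)) - ψ : 𝓢(V, ℂ)) : V → ℂ)
      = fun x => (θ ∘ L n) x * ψ x := by
    ext x
    simp [hval, θ, sub_mul]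
  rw [hcoe]
  have hn1 : (0 : ℝ) < (n : ℝ) + 1 := by positivity
  rcases lt_or_ge ‖x‖ ((n : ℝ) + 1) with hx | hx
  · have hev : (fun x => (θ ∘ L n) x * ψ x) =ᶠ[nhds x] fun _ => 0 := by
      filter_upwards [Metric.isOpen_ball.mem_nhds (mem_ball_zero_iff.2 hx)] with y hy
      have h1 : χ (L n y) = 1 := by
        refine χ.one_of_mem_closedBall ?_
        rw [mem_closedBall_zero_iff]
        simp only [L, smul_apply, ContinuousLinearMap.id_apply, norm_smul,
          norm_inv, Real.norm_of_nonneg hn1.le]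
        rw [inv_mul_le_iff₀ hn1, mul_one]
        exact (mem_ball_zero_iff.1 hy).le
      simp [θ, h1]
    rw [(hev.iteratedFDeriv ℝ l).eq_of_nhds]
    have : iteratedFDeriv ℝ l (fun _ : V => (0 : ℂ)) x = 0 := by
      have := iteratedFDeriv_fun_zero (𝕜 := ℝ) (E := V) (F := ℂ) (n := l)
      exact congrFun this x
    rw [this]
    simp only [norm_zero, mul_zero]
    positivity
  · have hcomp : ∀ i, ‖iteratedFDeriv ℝ i (θ ∘ L n) x‖ ≤ B i := by
      intro i
      rw [(L n).iteratedFDeriv_comp_right hθ x (by exact_mod_cast le_top)]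
      refine (ContinuousMultilinearMap.norm_compContinuousLinearMap_le _ _).trans ?_
      refine (mul_le_of_le_one_right (norm_nonneg _) ?_).trans (hB i _)
      exact Finset.prod_le_one (fun _ _ => norm_nonneg _) fun _ _ => hL n
    have hleib := norm_iteratedFDeriv_mul_le (𝕜 := ℝ) (f := θ ∘ L n) (g := ψ) (n := l)
      (N := (⊤ : ℕ∞)) (hθ.comp (L n).contDiff) (ψ.smooth ⊤) x (by exact_mod_cast le_top)
    have hstep : ‖x‖ ^ (k + 1) *
        ‖iteratedFDeriv ℝ l (fun x => (θ ∘ L n) x * ψ x) x‖ ≤ M := by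
      calc ‖x‖ ^ (k + 1) * ‖iteratedFDeriv ℝ l (fun x => (θ ∘ L n) x * ψ x) x‖
          ≤ ‖x‖ ^ (k + 1) * ∑ i ∈ Finset.range (l + 1), (l.choose i : ℝ) *
              ‖iteratedFDeriv ℝ i (θ ∘ L n) x‖ * ‖iteratedFDeriv ℝ (l - i) ψ x‖ := by gcongr
        _ ≤ M := by
            rw [Finset.mul_sum]
            refine Finset.sum_le_sum fun i _ => ?_
            have h1 := ψ.le_seminorm ℝ (k + 1) (l - i) x
            calc ‖x‖ ^ (k + 1) * ((l.choose i : ℝ) *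
                  ‖iteratedFDeriv ℝ i (θ ∘ L n) x‖ * ‖iteratedFDeriv ℝ (l - i) ψ x‖)
                = (l.choose i : ℝ) * ‖iteratedFDeriv ℝ i (θ ∘ L n) x‖ *
                  (‖x‖ ^ (k + 1) * ‖iteratedFDeriv ℝ (l - i) ψ x‖) := by ring
              _ ≤ _ := by gcongr; exact mul_nonneg (Nat.cast_nonneg _) (hB0 i); exact hcomp i
    rw [mul_one_div, le_div_iff₀ hn1]
    refine le_trans ?_ hstep
    calc ‖x‖ ^ k * ‖iteratedFDeriv ℝ l (fun x => (θ ∘ L n) x * ψ x) x‖ * ((n : ℝ) + 1)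
        ≤ ‖x‖ ^ k * ‖iteratedFDeriv ℝ l (fun x => (θ ∘ L n) x * ψ x) x‖ * ‖x‖ := by gcongr
      _ = _ := by ring

open Distribution in
theorem TemperedDistribution.apply_eq_zero_of_tsupport_subset (T : 𝓢'(V, ℂ)) (ψ : 𝓢(V, ℂ))
    (h : tsupport ψ ⊆ (dsupport T)ᶜ) : T ψ = 0 := by
  obtain ⟨u, huc, hus, hlim⟩ := SchwartzMap.exists_tendsto_hasCompactSupport ψ
  have h1 : Filter.Tendsto (fun n => T (u n)) Filter.atTop (nhds (T ψ)) :=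
    ((map_continuous T).tendsto ψ).comp hlim
  have h2 : (fun n => T (u n)) = fun _ => 0 := funext fun n =>
    T.apply_eq_zero_of_hasCompactSupport (u n) (huc n) ((hus n).trans h)
  rw [h2] at h1
  exact tendsto_nhds_unique h1 tendsto_const_nhds

end Support

/-! ### The reproducing kernel of a spectral box -/

section Translation

variable {V : Type*} [NormedAddCommGroup V] [InnerProductSpace ℝ V] [MeasurableSpace V]
  [BorelSpace V] [FiniteDimensional ℝ V]

theorem fourier_comp_sub (g : V → ℂ) (t ξ : V) :
    𝓕 (fun x => g (x - t)) ξ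
      = Complex.exp (((-2 * Real.pi * inner ℝ t ξ : ℝ) : ℂ) * Complex.I) * 𝓕 g ξ := by
  rw [Real.fourier_eq', Real.fourier_eq', ← integral_const_mul,
    ← integral_add_right_eq_self _ t]
  refine integral_congr_ae (Filter.Eventually.of_forall fun x => ?_)
  simp only [smul_eq_mul, add_sub_cancel_right]
  rw [← mul_assoc, ← Complex.exp_add, inner_add_left]
  congr 2
  push_cast
  ring

theorem fourierInv_comp_sub (g : V → ℂ) (t x : V) :
    𝓕⁻ (fun ξ => g (ξ - t)) x
      = Complex.exp (((2 * Real.pi * inner ℝ t x : ℝ) : ℂ) * Complex.I) * 𝓕⁻ g x := by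
  rw [Real.fourierInv_eq', Real.fourierInv_eq', ← integral_const_mul,
    ← integral_add_right_eq_self _ t]
  refine integral_congr_ae (Filter.Eventually.of_forall fun ξ => ?_)
  simp only [smul_eq_mul, add_sub_cancel_right]
  rw [← mul_assoc, ← Complex.exp_add, inner_add_left]
  congr 2
  push_cast
  ring

/-- Multiplying the inverse Fourier transform of `φ` by the Fourier multiplier `X` amounts to
averaging `φ` against translates of the kernel `𝓕⁻ X`. -/
theorem integral_mul_fourierInv_comp_sub (X φ : 𝓢(V, ℂ)) (t : V) :
    ∫ x, φ x * (𝓕⁻ X) (x - t) = 𝓕 (SchwartzMap.smulLeftCLM ℂ X (𝓕⁻ φ)) t := by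
  set K := SchwartzMap.compSubConstCLM ℂ t (𝓕⁻ X) with hK
  have hφ : φ = 𝓕 (𝓕⁻ φ) := (FourierTransform.fourier_fourierInv_eq φ).symm
  have h1 : ∫ x, φ x * (𝓕⁻ X) (x - t) = ∫ ξ, (𝓕⁻ φ) ξ * 𝓕 K ξ := by
    rw [← SchwartzMap.integral_fourier_mul_eq, ← hφ]
    simp [hK]
  rw [h1, SchwartzMap.fourier_coe (SchwartzMap.smulLeftCLM ℂ X (𝓕⁻ φ)), Real.fourier_eq']
  refine integral_congr_ae (Filter.Eventually.of_forall fun ξ => ?_)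
  have hKξ : 𝓕 K ξ = Complex.exp (((-2 * Real.pi * inner ℝ t ξ : ℝ) : ℂ) * Complex.I) * X ξ := by
    rw [SchwartzMap.fourier_coe]
    have : (K : V → ℂ) = fun x => (𝓕⁻ X) (x - t) := by ext x; simp [hK]
    rw [this, fourier_comp_sub, ← SchwartzMap.fourier_coe, FourierTransform.fourier_fourierInv_eq]
  simp only
  rw [hKξ, SchwartzMap.smulLeftCLM_apply_apply X.hasTemperateGrowth, real_inner_comm]
  simp only [smul_eq_mul]
  ring

end Translation

section Reproducing

variable {d : ℕ}

theorem integrable_mul_comp_sub {p : ℝ≥0∞} [hp : Fact (1 ≤ p)]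
    (f : Lp ℂ p (volume : Measure (EuclideanSpace ℝ (Fin d))))
    (K : 𝓢(EuclideanSpace ℝ (Fin d), ℂ)) (x : EuclideanSpace ℝ (Fin d)) :
    Integrable fun t => f t * K (x - t) := by
  have := ENNReal.HolderConjugate.inv_one_sub_inv' hp.out
  have hK : MemLp (fun t => K (x - t)) (1 - p⁻¹)⁻¹ volume :=
    (K.memLp (1 - p⁻¹)⁻¹ volume).comp_measurePreserving (Measure.measurePreserving_sub_left _ x)
  exact (Lp.memLp f).integrable_mul hK

theorem exists_lintegral_mul_comp_sub_le {p : ℝ≥0∞} [hp : Fact (1 ≤ p)]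
    (f : Lp ℂ p (volume : Measure (EuclideanSpace ℝ (Fin d))))
    (K : 𝓢(EuclideanSpace ℝ (Fin d), ℂ)) :
    ∃ C : ℝ≥0∞, C ≠ ∞ ∧ ∀ x, ∫⁻ t, ‖f t * K (x - t)‖ₑ ≤ C := by
  have := ENNReal.HolderConjugate.inv_one_sub_inv' hp.out
  refine ⟨eLpNorm f p volume * eLpNorm K (1 - p⁻¹)⁻¹ volume,
    ENNReal.mul_ne_top (Lp.memLp f).2.ne (K.memLp _ _).2.ne, fun x => ?_⟩
  have h1 : eLpNorm (fun t => K (x - t)) (1 - p⁻¹)⁻¹ volume = eLpNorm K (1 - p⁻¹)⁻¹ volume :=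
    eLpNorm_comp_measurePreserving K.continuous.aestronglyMeasurable
      (Measure.measurePreserving_sub_left _ x)
  rw [← h1, ← eLpNorm_one_eq_lintegral_enorm]
  have hKm : AEStronglyMeasurable (fun t => K (x - t)) volume :=
    (K.continuous.comp (by fun_prop)).aestronglyMeasurable
  have h2 := eLpNorm_smul_le_mul_eLpNorm (p := p) (q := (1 - p⁻¹)⁻¹) (r := 1) (φ := ⇑f) hKm
    (Lp.aestronglyMeasurable f)
  exact h2

theorem stronglyMeasurable_mul_comp_sub {p : ℝ≥0∞}
    (f : Lp ℂ p (volume : Measure (EuclideanSpace ℝ (Fin d))))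
    (K : 𝓢(EuclideanSpace ℝ (Fin d), ℂ)) :
    StronglyMeasurable fun q : EuclideanSpace ℝ (Fin d) × EuclideanSpace ℝ (Fin d) =>
      f q.2 * K (q.1 - q.2) :=
  ((Lp.stronglyMeasurable f).comp_measurable measurable_snd).mul
    (K.continuous.comp (by fun_prop)).stronglyMeasurable

theorem stronglyMeasurable_integral_mul_comp_sub {p : ℝ≥0∞}
    (f : Lp ℂ p (volume : Measure (EuclideanSpace ℝ (Fin d))))
    (K : 𝓢(EuclideanSpace ℝ (Fin d), ℂ)) :
    StronglyMeasurable fun x => ∫ t, f t * K (x - t) :=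
  (stronglyMeasurable_mul_comp_sub f K).integral_prod_right

theorem integrable_uncurry_mul_mul_comp_sub {p : ℝ≥0∞} [Fact (1 ≤ p)]
    (f : Lp ℂ p (volume : Measure (EuclideanSpace ℝ (Fin d))))
    (K φ : 𝓢(EuclideanSpace ℝ (Fin d), ℂ)) :
    Integrable (Function.uncurry fun x t => φ x * (f t * K (x - t))) (volume.prod volume) := by
  obtain ⟨C, hC, hbound⟩ := exists_lintegral_mul_comp_sub_le f K
  have hm : StronglyMeasurable (Function.uncurry fun x t => φ x * (f t * K (x - t))) :=
    (φ.continuous.stronglyMeasurable.comp_measurable measurable_fst).mul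
      (stronglyMeasurable_mul_comp_sub f K)
  refine ⟨hm.aestronglyMeasurable, ?_⟩
  rw [HasFiniteIntegral, lintegral_prod _ hm.enorm.aemeasurable]
  calc ∫⁻ x, ∫⁻ t, ‖φ x * (f t * K (x - t))‖ₑ
      ≤ ∫⁻ x, ‖φ x‖ₑ * C := by
        refine lintegral_mono fun x => ?_
        simp only [enorm_mul (φ x)]
        rw [lintegral_const_mul' _ _ enorm_ne_top]
        gcongr
        exact hbound x
    _ = (∫⁻ x, ‖φ x‖ₑ) * C := lintegral_mul_const' _ _ hC
    _ < ∞ := ENNReal.mul_lt_top φ.integrable.2 hC.lt_top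

/-- A function in `L^p` is reproduced by convolution with `𝓕⁻ X` as soon as `X = 1` near its
spectrum. -/
theorem ae_eq_integral_mul_fourierInv {p : ℝ≥0∞} [Fact (1 ≤ p)]
    (f : Lp ℂ p (volume : Measure (EuclideanSpace ℝ (Fin d))))
    (X : 𝓢(EuclideanSpace ℝ (Fin d), ℂ))
    (hX : ∀ ξ ∈ Distribution.dsupport
      (𝓕 (Lp.toTemperedDistribution f) : 𝓢'(EuclideanSpace ℝ (Fin d), ℂ)),
      ∀ᶠ η in nhds ξ, X η = 1) :
    ∀ᵐ x, f x = ∫ t, f t * (𝓕⁻ X) (x - t) := by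
  set T : 𝓢'(EuclideanSpace ℝ (Fin d), ℂ) := Lp.toTemperedDistribution f with hT
  have hrepr : ∀ φ : 𝓢(EuclideanSpace ℝ (Fin d), ℂ),
      T φ = T (𝓕 (SchwartzMap.smulLeftCLM ℂ X (𝓕⁻ φ))) := by
    intro φ
    have h0 : (𝓕 T) (𝓕⁻ φ - SchwartzMap.smulLeftCLM ℂ X (𝓕⁻ φ)) = 0 := by
      refine TemperedDistribution.apply_eq_zero_of_tsupport_subset _ _ fun ξ hξ hξd =>
        (notMem_tsupport_iff_eventuallyEq.2 ?_) hξ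
      filter_upwards [hX ξ hξd] with η hη
      simp [SchwartzMap.smulLeftCLM_apply_apply X.hasTemperateGrowth, hη]
    rw [map_sub, sub_eq_zero] at h0
    simpa [TemperedDistribution.fourier_apply, FourierTransform.fourier_fourierInv_eq] using h0
  obtain ⟨C, hC, hbound⟩ := exists_lintegral_mul_comp_sub_le f (𝓕⁻ X)
  set F : EuclideanSpace ℝ (Fin d) → ℂ := fun x => ∫ t, f t * (𝓕⁻ X) (x - t) with hF
  have hFm : StronglyMeasurable F := stronglyMeasurable_integral_mul_comp_sub f (𝓕⁻ X)
  have hFb : ∀ x, ‖F x‖ ≤ C.toReal := fun x => by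
    rw [← toReal_enorm]
    exact ENNReal.toReal_mono hC ((enorm_integral_le_lintegral_enorm _).trans (hbound x))
  have hFloc : LocallyIntegrable F volume := by
    refine (locallyIntegrable_const C.toReal).mono hFm.aestronglyMeasurable
      (Filter.Eventually.of_forall fun x => (hFb x).trans (le_abs_self _))
  have hfloc : LocallyIntegrable f volume := (Lp.memLp f).locallyIntegrable Fact.out
  have key := ae_eq_zero_of_integral_contDiff_smul_eq_zero (hfloc.sub hFloc) ?_
  · filter_upwards [key] with x hx
    simpa [sub_eq_zero] using hx
  intro g hg hgs
  have hgs' : HasCompactSupport fun x => (g x : ℂ) :=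
    hgs.comp_left (g := fun x : ℝ => (x : ℂ)) (by simp)
  let φ : 𝓢(EuclideanSpace ℝ (Fin d), ℂ) :=
    hgs'.toSchwartzMap (Complex.ofRealCLM.contDiff.comp hg)
  have hφ : ∀ x, φ x = (g x : ℂ) := fun x => rfl
  have hTφ : T φ = ∫ x, φ x * f x := by
    rw [hT, Lp.toTemperedDistribution_apply]
    rfl
  have hint := integrable_uncurry_mul_mul_comp_sub f (𝓕⁻ X) φ
  have hTφ' : T φ = ∫ x, φ x * F x := by
    rw [hrepr φ, hT, Lp.toTemperedDistribution_apply]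
    simp only [← integral_mul_fourierInv_comp_sub, hF, smul_eq_mul]
    calc ∫ t, (∫ x, φ x * (𝓕⁻ X) (x - t)) * f t
        = ∫ t, ∫ x, φ x * (f t * (𝓕⁻ X) (x - t)) := by
          congr 1; ext t
          rw [← integral_mul_const]
          congr 1; ext x; ring
      _ = ∫ x, ∫ t, φ x * (f t * (𝓕⁻ X) (x - t)) := (integral_integral_swap hint).symm
      _ = _ := by
          congr 1; ext x
          rw [integral_const_mul]
  have h1 : Integrable fun x => φ x * f x :=
    hfloc.integrable_smul_left_of_hasCompactSupport φ.continuous hgs'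
  have h2 : Integrable fun x => φ x * F x :=
    hFloc.integrable_smul_left_of_hasCompactSupport φ.continuous hgs'
  calc ∫ x, g x • (f - F) x = ∫ x, (φ x * f x - φ x * F x) := by
        congr 1; ext x
        simp [hφ, mul_sub]
    _ = 0 := by rw [integral_sub h1 h2, ← hTφ, ← hTφ', sub_self]

theorem hasCompactSupport_prod_cutoff (c : Fin d → ℝ) {b : Fin d → ℝ} (hb : ∀ k, 0 < b k) :
    HasCompactSupport fun ξ : EuclideanSpace ℝ (Fin d) =>
      ∏ k, (cutoff ((ξ k - c k) / b k) : ℂ) := by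
  refine HasCompactSupport.of_support_subset_isCompact
    (K := WithLp.ofLp ⁻¹' Set.Icc (fun k => c k - 2 * b k) (fun k => c k + 2 * b k))
    ((PiLp.homeomorph 2 (fun _ : Fin d => ℝ)).isCompact_preimage.2 isCompact_Icc) fun ξ hξ => ?_
  have h : ∀ k, |ξ k - c k| ≤ 2 * b k := by
    intro k
    by_contra! hlt
    refine hξ (Finset.prod_eq_zero (Finset.mem_univ k) ?_)
    rw [cutoff_eq_zero, Complex.ofReal_zero]
    rw [abs_div, abs_of_pos (hb k), le_div_iff₀ (hb k)]
    exact hlt.le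
  constructor <;> intro k <;> have := abs_le.1 (h k) <;> simp only <;> linarith

theorem contDiff_prod_cutoff (c b : Fin d → ℝ) :
    ContDiff ℝ (⊤ : ℕ∞) fun ξ : EuclideanSpace ℝ (Fin d) =>
      ∏ k, (cutoff ((ξ k - c k) / b k) : ℂ) := by
  refine contDiff_prod fun k _ => Complex.ofRealCLM.contDiff.comp (cutoff.contDiff.comp ?_)
  fun_prop

/-- The smooth cutoff to the box with centre `c`: it equals `1` where `|ξ k - c k| ≤ b k` for
all `k`, and `0` where `|ξ k - c k| ≥ 2 b k` for some `k`. -/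
noncomputable def boxCutoff (c : Fin d → ℝ) {b : Fin d → ℝ} (hb : ∀ k, 0 < b k) :
    𝓢(EuclideanSpace ℝ (Fin d), ℂ) :=
  (hasCompactSupport_prod_cutoff c hb).toSchwartzMap (contDiff_prod_cutoff c b)

theorem boxCutoff_apply (c : Fin d → ℝ) {b : Fin d → ℝ} (hb : ∀ k, 0 < b k)
    (ξ : EuclideanSpace ℝ (Fin d)) :
    boxCutoff c hb ξ = ∏ k, (cutoff ((ξ k - c k) / b k) : ℂ) := rfl

theorem integral_cutoff_mul_exp (c : ℝ) {b : ℝ} (hb : 0 < b) (x : ℝ) :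
    ∫ ξ : ℝ, (cutoff ((ξ - c) / b) : ℂ) * Complex.exp (2 * Real.pi * Complex.I * x * ξ)
      = Complex.exp (2 * Real.pi * Complex.I * (c * x)) * (b * cutoffKernel (b * x)) := by
  rw [← integral_add_right_eq_self _ c]
  set G : ℝ → ℂ := fun η => Complex.exp (2 * Real.pi * Complex.I * (c * x)) * ((cutoff η : ℂ) *
    Complex.exp (2 * Real.pi * Complex.I * (b * x) * η)) with hG
  have h1 : ∀ ξ : ℝ, (cutoff ((ξ + c - c) / b) : ℂ) *
        Complex.exp (2 * Real.pi * Complex.I * x * (ξ + c : ℝ)) = G (ξ / b) := by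
    intro ξ
    have hb' : (b : ℂ) ≠ 0 := by exact_mod_cast hb.ne'
    simp only [hG, add_sub_cancel_right]
    rw [mul_left_comm, ← Complex.exp_add]
    congr 2
    push_cast
    field_simp
    ring
  simp only [h1]
  rw [Measure.integral_comp_div G, hG, integral_const_mul, abs_of_pos hb, cutoffKernel]
  simp only [Complex.real_smul]
  ring

theorem fourierInv_boxCutoff (c : Fin d → ℝ) {b : Fin d → ℝ} (hb : ∀ k, 0 < b k)
    (x : EuclideanSpace ℝ (Fin d)) :
    (𝓕⁻ (boxCutoff c hb)) x = ∏ k, (Complex.exp (2 * Real.pi * Complex.I * (c k * x k)) *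
      (b k * cutoffKernel (b k * x k))) := by
  simp only [← integral_cutoff_mul_exp _ (hb _)]
  rw [SchwartzMap.fourierInv_coe, Real.fourierInv_eq',
    ← integral_fintype_prod_volume_eq_prod (ι := Fin d) (E := fun _ => ℝ)
      (fun k ξ => (cutoff ((ξ - c k) / b k) : ℂ) * Complex.exp (2 * Real.pi * Complex.I * x k * ξ)),
    ← (PiLp.volume_preserving_ofLp (Fin d)).integral_comp
      (PiLp.homeomorph 2 (fun _ : Fin d => ℝ)).measurableEmbedding]
  congr 1
  ext ξ
  rw [boxCutoff_apply, Finset.prod_mul_distrib, ← Complex.exp_sum, smul_eq_mul, mul_comm]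
  congr 2
  rw [PiLp.inner_apply]
  push_cast
  rw [Finset.mul_sum, Finset.sum_mul]
  refine Finset.sum_congr rfl fun k _ => ?_
  simp
  ring

end Reproducing

/-! ### Bounds for the kernel on complex neighbourhoods -/

/-- The growth factor of the kernel of bandwidth `b` on the complex disc of radius `3 a`;
`C` is the constant of `exists_norm_cutoffKernel_le`. -/
noncomputable def kernelGrowth (C a b : ℝ) : ℝ :=
  2 * C * (1 + 9 * (a * b) ^ 2) * Real.exp (12 * Real.pi * (a * b))

theorem kernelGrowth_nonneg {C : ℝ} (hC : 0 ≤ C) (a b : ℝ) : 0 ≤ kernelGrowth C a b := by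
  unfold kernelGrowth
  positivity

/-- The one-dimensional factor of the kernel, continued to complex arguments `y + z v` with
`‖z‖ ≤ 3` and `0 ≤ v ≤ a`, decays quadratically in `b * y`. -/
theorem norm_mul_cutoffKernel_le {C : ℝ} (hC0 : 0 ≤ C)
    (hC : ∀ z : ℂ, ‖cutoffKernel z‖ * (1 + z.re ^ 2) ≤ C * Real.exp (4 * Real.pi * |z.im|))
    {a b v : ℝ} (hb : 0 < b) (hv0 : 0 ≤ v) (hva : v ≤ a) (y : ℝ) {z : ℂ} (hz : ‖z‖ ≤ 3) :
    ‖(b : ℂ) * cutoffKernel (b * (y + z * v))‖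
      ≤ kernelGrowth C a b * (b / (1 + (b * y) ^ 2)) := by
  have hre : ((b : ℂ) * (y + z * v)).re = b * y + b * v * z.re := by simp; ring
  have him : ((b : ℂ) * (y + z * v)).im = b * v * z.im := by simp; ring
  have h1 := hC ((b : ℂ) * (y + z * v))
  rw [hre, him] at h1
  have hbv : b * v ≤ a * b := by nlinarith
  have hbv0 : 0 ≤ b * v := by positivity
  have hzre : |z.re| ≤ 3 := (Complex.abs_re_le_norm z).trans hz
  have hzim : |z.im| ≤ 3 := (Complex.abs_im_le_norm z).trans hz
  have hexp : Real.exp (4 * Real.pi * |b * v * z.im|) ≤ Real.exp (12 * Real.pi * (a * b)) := by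
    apply Real.exp_le_exp.2
    rw [abs_mul, abs_of_nonneg hbv0]
    have : b * v * |z.im| ≤ a * b * 3 := by gcongr; linarith
    nlinarith [Real.pi_pos]
  set s := b * v * z.re with hs
  set u := b * y with hu
  have hs2 : s ^ 2 ≤ 9 * (a * b) ^ 2 := by
    have : |s| ≤ a * b * 3 := by
      rw [hs, abs_mul, abs_of_nonneg hbv0]; gcongr; linarith
    nlinarith [sq_abs s, abs_nonneg s]
  -- Peetre's inequality: the shift by `s` changes the weight by a bounded factor only.
  have hpeetre : 1 + u ^ 2 ≤ 2 * (1 + 9 * (a * b) ^ 2) * (1 + (u + s) ^ 2) := by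
    nlinarith [sq_nonneg (u + 2 * s), mul_nonneg (sq_nonneg s) (sq_nonneg (u + s)),
      sq_nonneg (u + s), mul_le_mul_of_nonneg_right hs2 (sq_nonneg (u + s))]
  have hpos : 0 < 1 + (u + s) ^ 2 := by positivity
  rw [norm_mul, Complex.norm_real, Real.norm_of_nonneg hb.le, mul_div_assoc', le_div_iff₀
    (by positivity)]
  set N := ‖cutoffKernel (b * (y + z * v))‖
  have hN : 0 ≤ N := norm_nonneg _
  calc b * N * (1 + u ^ 2) ≤ b * N * (2 * (1 + 9 * (a * b) ^ 2) * (1 + (u + s) ^ 2)) := by gcongr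
    _ = b * (2 * (1 + 9 * (a * b) ^ 2)) * (N * (1 + (u + s) ^ 2)) := by ring
    _ ≤ b * (2 * (1 + 9 * (a * b) ^ 2)) * (C * Real.exp (12 * Real.pi * (a * b))) := by
        exact mul_le_mul_of_nonneg_left (h1.trans (by gcongr)) (by positivity)
    _ = kernelGrowth C a b * b := by unfold kernelGrowth; ring

theorem integrable_div_one_add_mul_sq {b : ℝ} (hb : 0 < b) :
    Integrable fun y : ℝ => b / (1 + (b * y) ^ 2) := by
  simpa [div_eq_mul_inv] using
    ((integrable_inv_one_add_sq.comp_mul_left' hb.ne').const_mul b)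

theorem integral_div_one_add_mul_sq {b : ℝ} (hb : 0 < b) :
    ∫ y : ℝ, b / (1 + (b * y) ^ 2) = Real.pi := by
  simp only [div_eq_mul_inv]
  rw [integral_const_mul, Measure.integral_comp_mul_left (fun y => (1 + y ^ 2)⁻¹),
    integral_univ_inv_one_add_sq, abs_of_pos (inv_pos.2 hb), smul_eq_mul]
  field_simp

section Majorant

variable {d : ℕ}

/-- An integrable majorant of the reproducing kernel on a complex neighbourhood of a box with side
lengths `a`. -/
noncomputable def kernelMajorant (C : ℝ) (a b : Fin d → ℝ) (y : EuclideanSpace ℝ (Fin d)) : ℝ :=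
  ∏ k, (kernelGrowth C (a k) (b k) * (b k / (1 + (b k * y k) ^ 2)))

theorem continuous_kernelMajorant (C : ℝ) (a b : Fin d → ℝ) :
    Continuous (kernelMajorant C a b) := by
  unfold kernelMajorant
  refine continuous_finsetProd _ fun k _ => continuous_const.mul ?_
  exact continuous_const.div (by fun_prop) fun y => by positivity

theorem kernelMajorant_nonneg {C : ℝ} (hC : 0 ≤ C) (a : Fin d → ℝ) {b : Fin d → ℝ}
    (hb : ∀ k, 0 < b k) (y : EuclideanSpace ℝ (Fin d)) : 0 ≤ kernelMajorant C a b y :=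
  Finset.prod_nonneg fun k _ => mul_nonneg (kernelGrowth_nonneg hC _ _)
    (div_nonneg (hb k).le (by positivity))

theorem lintegral_kernelMajorant {C : ℝ} (hC : 0 ≤ C) (a : Fin d → ℝ) {b : Fin d → ℝ}
    (hb : ∀ k, 0 < b k) :
    ∫⁻ y, ENNReal.ofReal (kernelMajorant C a b y)
      = ENNReal.ofReal (∏ k, (kernelGrowth C (a k) (b k) * Real.pi)) := by
  have hint : Integrable (fun y : Fin d → ℝ =>
      ∏ k, (kernelGrowth C (a k) (b k) * (b k / (1 + (b k * y k) ^ 2)))) volume :=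
    Integrable.fintype_prod (f := fun k y =>
      kernelGrowth C (a k) (b k) * (b k / (1 + (b k * y) ^ 2)))
      fun k => (integrable_div_one_add_mul_sq (hb k)).const_mul _
  have hemb := (PiLp.homeomorph 2 (fun _ : Fin d => ℝ)).measurableEmbedding
  have hint' : Integrable (kernelMajorant C a b) :=
    ((PiLp.volume_preserving_ofLp (Fin d)).integrable_comp_emb hemb).2 hint
  rw [← ofReal_integral_eq_lintegral_ofReal hint'
    (Filter.Eventually.of_forall fun y => kernelMajorant_nonneg hC a hb y)]
  congr 1
  calc ∫ y, kernelMajorant C a b y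
      = ∫ y : Fin d → ℝ, ∏ k, (kernelGrowth C (a k) (b k) * (b k / (1 + (b k * y k) ^ 2))) :=
        (PiLp.volume_preserving_ofLp (Fin d)).integral_comp hemb (fun y : Fin d → ℝ =>
          ∏ k, (kernelGrowth C (a k) (b k) * (b k / (1 + (b k * y k) ^ 2))))
    _ = _ := by
        rw [integral_fintype_prod_volume_eq_prod (ι := Fin d) (E := fun _ => ℝ) (fun k y =>
          kernelGrowth C (a k) (b k) * (b k / (1 + (b k * y) ^ 2)))]
        refine Finset.prod_congr rfl fun k _ => ?_
        rw [integral_const_mul, integral_div_one_add_mul_sq (hb k)]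

/-- The mass of the majorant is at most exponential in `d + ∑ k, a k * b k`. -/
theorem prod_kernelGrowth_mul_pi_le {C : ℝ} (hC : 1 ≤ C) {a b : Fin d → ℝ} (ha : ∀ k, 0 < a k)
    (hb : ∀ k, 0 < b k) :
    ∏ k, (kernelGrowth C (a k) (b k) * Real.pi)
      ≤ Real.exp ((38 * C * Real.pi + 12 * Real.pi + 1) * (d + ∑ k, a k * b k)) := by
  have hterm : ∀ k, kernelGrowth C (a k) (b k) * Real.pi
      ≤ Real.exp ((38 * C * Real.pi + 12 * Real.pi + 1) * (1 + a k * b k)) := by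
    intro k
    have ht : 0 < a k * b k := mul_pos (ha k) (hb k)
    set t := a k * b k with htdef
    have h1 : 1 + 9 * t ^ 2 ≤ 19 * Real.exp t := by
      have h2 := Real.quadratic_le_exp_of_nonneg ht.le
      nlinarith
    have h3 : 38 * C * Real.pi ≤ Real.exp (38 * C * Real.pi) := by
      linarith [Real.add_one_le_exp (38 * C * Real.pi)]
    have hp := Real.pi_pos
    calc kernelGrowth C (a k) (b k) * Real.pi
        = 2 * C * Real.pi * (1 + 9 * t ^ 2) * Real.exp (12 * Real.pi * t) := by
          unfold kernelGrowth; ring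
      _ ≤ 2 * C * Real.pi * (19 * Real.exp t) * Real.exp (12 * Real.pi * t) := by gcongr
      _ = (38 * C * Real.pi) * Real.exp (t + 12 * Real.pi * t) := by rw [Real.exp_add]; ring
      _ ≤ Real.exp (38 * C * Real.pi) * Real.exp (t + 12 * Real.pi * t) := by gcongr
      _ ≤ _ := by
          rw [← Real.exp_add]
          apply Real.exp_le_exp.2
          nlinarith [mul_pos (mul_pos (show (0 : ℝ) < C by linarith) hp) ht]
  calc ∏ k, (kernelGrowth C (a k) (b k) * Real.pi)
      ≤ ∏ k, Real.exp ((38 * C * Real.pi + 12 * Real.pi + 1) * (1 + a k * b k)) :=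
        Finset.prod_le_prod (fun k _ => mul_nonneg (kernelGrowth_nonneg (by linarith) _ _)
          Real.pi_pos.le) fun k _ => hterm k
    _ = _ := by
        rw [← Real.exp_sum, ← Finset.mul_sum, Finset.sum_add_distrib]
        simp

end Majorant

/-! ### The local estimate at a point -/

section Local

variable {d : ℕ}

/-- Extrapolation for a function in the range of the reproducing kernel, from nodes on the segment
from `x₀` in direction `v`, at a point `x₀` where the function is not small compared to its average
against the majorant. -/
theorem norm_le_sum_basis_add_half {C : ℝ} (hC0 : 0 ≤ C)
    (hC : ∀ z : ℂ, ‖cutoffKernel z‖ * (1 + z.re ^ 2) ≤ C * Real.exp (4 * Real.pi * |z.im|))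
    {p : ℝ≥0∞} [Fact (1 ≤ p)] (f : Lp ℂ p (volume : Measure (EuclideanSpace ℝ (Fin d))))
    (c : Fin d → ℝ) {a b : Fin d → ℝ} (hb : ∀ k, 0 < b k) {m : ℕ}
    {x₀ v : EuclideanSpace ℝ (Fin d)} (hv0 : ∀ k, 0 ≤ v k) (hva : ∀ k, v k ≤ a k)
    (hB : ∫⁻ t, ‖f t‖ₑ * ENNReal.ofReal (kernelMajorant C a b (x₀ - t))
      ≤ 2 ^ m * ‖∫ t, f t * (𝓕⁻ (boxCutoff c hb)) (x₀ - t)‖ₑ)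
    {s : Fin (m + 1) → ℝ} (hs : Function.Injective s) (hs0 : ∀ i, 0 < s i) (hs1 : ∀ i, s i ≤ 1) :
    ‖∫ t, f t * (𝓕⁻ (boxCutoff c hb)) (x₀ - t)‖ ≤
      ∑ i, ‖(Lagrange.basis Finset.univ (fun i => (s i : ℂ)) i).eval 0‖ *
        ‖∫ t, f t * (𝓕⁻ (boxCutoff c hb)) (x₀ + s i • v - t)‖
      + ‖∫ t, f t * (𝓕⁻ (boxCutoff c hb)) (x₀ - t)‖ / 2 := by
  set K : 𝓢(EuclideanSpace ℝ (Fin d), ℂ) := 𝓕⁻ (boxCutoff c hb) with hK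
  set l : Fin (m + 1) → ℂ :=
    fun i => (Lagrange.basis Finset.univ (fun i => (s i : ℂ)) i).eval 0 with hl
  -- The modulation moving the spectral box to the origin.
  set e : EuclideanSpace ℝ (Fin d) → ℂ :=
    fun x => Complex.exp (((-(2 * Real.pi * ∑ k, c k * x k) : ℝ) : ℂ) * Complex.I) with he
  have he1 : ∀ x, ‖e x‖ = 1 := fun x => Complex.norm_exp_ofReal_mul_I _
  set φ : EuclideanSpace ℝ (Fin d) → ℂ → ℂ :=
    fun y z => ∏ k, ((b k : ℂ) * cutoffKernel (b k * (y k + z * v k))) with hφ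
  have hφd : ∀ y, Differentiable ℂ (φ y) := fun y => by
    refine Differentiable.fun_finsetProd fun k _ => (differentiable_const _).mul ?_
    exact differentiable_cutoffKernel.comp (by fun_prop)
  have hφb : ∀ y z, ‖z‖ = 3 → ‖φ y z‖ ≤ kernelMajorant C a b y := fun y z hz => by
    rw [hφ, norm_prod]
    exact Finset.prod_le_prod (fun _ _ => norm_nonneg _) fun k _ =>
      norm_mul_cutoffKernel_le hC0 hC (hb k) (hv0 k) (hva k) (y k) hz.le
  have hKφ : ∀ (r : ℝ) t, e (x₀ + r • v) * (f t * K (x₀ + r • v - t))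
      = f t * e t * φ (x₀ - t) r := by
    intro r t
    have h1 : K (x₀ + r • v - t)
        = Complex.exp (2 * Real.pi * Complex.I * ∑ k, (c k * (x₀ + r • v - t) k : ℂ)) *
          φ (x₀ - t) r := by
      rw [hK, fourierInv_boxCutoff, Finset.prod_mul_distrib, ← Complex.exp_sum, ← Finset.mul_sum]
      congr 1
      refine Finset.prod_congr rfl fun k _ => ?_
      simp only [PiLp.sub_apply, PiLp.add_apply, PiLp.smul_apply, smul_eq_mul]
      congr 3
      push_cast
      ring
    have h2 : e (x₀ + r • v) * Complex.exp (2 * Real.pi * Complex.I *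
        ∑ k, (c k * (x₀ + r • v - t) k : ℂ)) = e t := by
      simp only [he]
      rw [← Complex.exp_add]
      congr 1
      have h3 : ∑ k, (c k * (x₀ + r • v - t) k : ℂ)
          = ((∑ k, c k * (x₀ + r • v) k - ∑ k, c k * t k : ℝ) : ℂ) := by
        rw [← Finset.sum_sub_distrib]
        push_cast
        refine Finset.sum_congr rfl fun k _ => ?_
        simp only [PiLp.sub_apply]
        push_cast
        ring
      rw [h3]
      push_cast
      ring
    rw [h1, ← h2]
    ring
  have hint : ∀ r : ℝ, Integrable fun t => f t * e t * φ (x₀ - t) r := fun r => by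
    simp only [← hKφ]
    exact (integrable_mul_comp_sub f K _).const_mul _
  have hF : ∀ r : ℝ, e (x₀ + r • v) * ∫ t, f t * K (x₀ + r • v - t)
      = ∫ t, f t * e t * φ (x₀ - t) r := fun r => by
    simp only [← hKφ]
    rw [integral_const_mul]
  have hF0 : e x₀ * ∫ t, f t * K (x₀ - t) = ∫ t, f t * e t * φ (x₀ - t) 0 := by
    simpa using hF 0
  have hint0 : Integrable fun t => f t * e t * φ (x₀ - t) 0 := by simpa using hint 0
  set F₀ := ∫ t, f t * K (x₀ - t) with hF₀
  have hdiff : e x₀ * F₀ - ∑ i, l i * (e (x₀ + s i • v) * ∫ t, f t * K (x₀ + s i • v - t))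
      = ∫ t, f t * e t * (φ (x₀ - t) 0 - ∑ i, l i * φ (x₀ - t) (s i)) := by
    rw [hF0]
    simp only [hF, ← integral_const_mul]
    rw [← integral_finsetSum _ fun i _ => (hint (s i)).const_mul (l i), ← integral_sub hint0
      (integrable_finsetSum _ fun i _ => (hint (s i)).const_mul (l i))]
    refine integral_congr_ae (Filter.Eventually.of_forall fun t => ?_)
    simp only [mul_sub, Finset.mul_sum]
    congr 1
    refine Finset.sum_congr rfl fun i _ => ?_
    ring
  have hrem : ‖∫ t, f t * e t * (φ (x₀ - t) 0 - ∑ i, l i * φ (x₀ - t) (s i))‖ₑ ≤ ‖F₀‖ₑ / 2 := by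
    refine (enorm_integral_le_lintegral_enorm _).trans ?_
    calc ∫⁻ t, ‖f t * e t * (φ (x₀ - t) 0 - ∑ i, l i * φ (x₀ - t) (s i))‖ₑ
        ≤ ∫⁻ t, ‖f t‖ₑ * ENNReal.ofReal (kernelMajorant C a b (x₀ - t)) * (2 ^ (m + 1))⁻¹ := by
          refine lintegral_mono fun t => ?_
          rw [enorm_mul, enorm_mul, ← ofReal_norm (e t), he1, ENNReal.ofReal_one, mul_one, mul_assoc]
          gcongr
          have h1 := norm_sub_sum_basis_mul_le hs hs0 hs1 (hφd (x₀ - t)) (hφb (x₀ - t))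
          rw [← ofReal_norm]
          refine (ENNReal.ofReal_le_ofReal h1).trans_eq ?_
          rw [ENNReal.ofReal_div_of_pos (by positivity), div_eq_mul_inv,
            ENNReal.ofReal_pow (by norm_num), ENNReal.ofReal_ofNat]
      _ = (∫⁻ t, ‖f t‖ₑ * ENNReal.ofReal (kernelMajorant C a b (x₀ - t))) * (2 ^ (m + 1))⁻¹ :=
          lintegral_mul_const' _ _ (ENNReal.inv_ne_top.2 (by positivity))
      _ ≤ 2 ^ m * ‖F₀‖ₑ * (2 ^ (m + 1))⁻¹ := by gcongr
      _ = ‖F₀‖ₑ / 2 := by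
          rw [pow_succ, ENNReal.mul_inv (Or.inl (by positivity)) (Or.inl (by finiteness)),
            div_eq_mul_inv, mul_comm (2 ^ m) ‖F₀‖ₑ, mul_assoc, ← mul_assoc (2 ^ m) _ _,
            ENNReal.mul_inv_cancel (by positivity) (by finiteness), one_mul]
  have hrem' : ‖∫ t, f t * e t * (φ (x₀ - t) 0 - ∑ i, l i * φ (x₀ - t) (s i))‖ ≤ ‖F₀‖ / 2 := by
    have := ENNReal.toReal_mono (by finiteness) hrem
    simpa using this
  rw [← hdiff] at hrem'
  calc ‖F₀‖ = ‖e x₀ * F₀‖ := by rw [norm_mul, he1, one_mul]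
    _ ≤ ‖∑ i, l i * (e (x₀ + s i • v) * ∫ t, f t * K (x₀ + s i • v - t))‖
        + ‖e x₀ * F₀ - ∑ i, l i * (e (x₀ + s i • v) * ∫ t, f t * K (x₀ + s i • v - t))‖ := by
        rw [add_comm]
        simpa using norm_add_le (e x₀ * F₀ - ∑ i, l i *
          (e (x₀ + s i • v) * ∫ t, f t * K (x₀ + s i • v - t))) (∑ i, l i *
          (e (x₀ + s i • v) * ∫ t, f t * K (x₀ + s i • v - t)))
    _ ≤ _ := by
        refine add_le_add ((norm_sum_le _ _).trans_eq ?_) hrem'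
        refine Finset.sum_congr rfl fun i _ => ?_
        rw [norm_mul, norm_mul, he1, one_mul]

end Local

section LargeValues

variable {d : ℕ}

/-- If the value of `F` at the corner of a box can be extrapolated along every segment in the box,
then `F` is not much smaller than at the corner on a subset of relative measure `γ / 2` of any set
`E` of relative measure `γ` in the box. -/
theorem le_volume_setOf_mul_norm_le (hd : 1 ≤ d) {a : Fin d → ℝ} (ha : ∀ k, 0 < a k)
    {F : EuclideanSpace ℝ (Fin d) → ℂ} (hFm : Measurable F) {x₀ : EuclideanSpace ℝ (Fin d)} {m : ℕ}
    (hF : ∀ v : EuclideanSpace ℝ (Fin d), (∀ k, 0 ≤ v k) → (∀ k, v k ≤ a k) →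
      ∀ s : Fin (m + 1) → ℝ, Function.Injective s → (∀ i, 0 < s i) → (∀ i, s i ≤ 1) →
      ‖F x₀‖ ≤ ∑ i, ‖(Lagrange.basis Finset.univ (fun i => (s i : ℂ)) i).eval 0‖ *
        ‖F (x₀ + s i • v)‖ + ‖F x₀‖ / 2)
    {E : Set (EuclideanSpace ℝ (Fin d))} (hE : MeasurableSet E) {γ : ℝ} (hγ0 : 0 < γ) (hγ1 : γ ≤ 1)
    (hEγ : ENNReal.ofReal γ * volume (axisBox x₀ a) ≤ volume (E ∩ axisBox x₀ a)) :
    ENNReal.ofReal (γ / 2) * volume (axisBox x₀ a) ≤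
      volume {y ∈ E ∩ axisBox x₀ a | (γ ^ 2 / (192 * d)) ^ m / 12 * ‖F x₀‖ ≤ ‖F y‖} := by
  have hd' : (1 : ℝ) ≤ d := by exact_mod_cast hd
  set Q := axisBox x₀ a with hQ
  have hQm : MeasurableSet Q := measurableSet_axisBox _ _
  have hQtop : volume Q ≠ ∞ := volume_axisBox_ne_top _ _
  set ε := (γ ^ 2 / (192 * d)) ^ m / 12 with hε
  set A := {y ∈ E ∩ Q | ‖F y‖ < ε * ‖F x₀‖} with hA
  set G := {y ∈ E ∩ Q | ε * ‖F x₀‖ ≤ ‖F y‖} with hG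
  have hAm : MeasurableSet A := (hE.inter hQm).inter (measurableSet_lt hFm.norm measurable_const)
  have hAsmall : volume A ≤ ENNReal.ofReal (γ / 2) * volume Q := by
    by_contra! hlt
    obtain ⟨y, hyQ, hy⟩ := exists_segment_of_le_volume hd ha hAm (fun z hz => hz.1.2)
      (half_pos hγ0) (by linarith) hlt.le
    set T := {t : ℝ | t ∈ Set.Ioc (0 : ℝ) 1 ∧ AffineMap.homothety x₀ t y ∈ A} with hT
    set η := (γ / 2) ^ 2 / (4 * d) with hη
    have hη0 : 0 < η := by positivity
    have hm1 : (0 : ℝ) < m + 1 := by positivity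
    have hh : 0 < η / (m + 1) := by positivity
    obtain ⟨s, hsT, hs⟩ := exists_separated_nodes (m := m) (T := T) hh.le ⟨0, fun t ht => ht.1.1.le⟩
      (by
        refine lt_of_lt_of_le ((ENNReal.ofReal_lt_ofReal_iff hη0).2 ?_) hy
        rw [mul_div_assoc', div_lt_iff₀ hm1]
        nlinarith)
    have hsep : ∀ i j : Fin (m + 1),
        |((i : ℕ) : ℝ) - ((j : ℕ) : ℝ)| * (η / (m + 1)) ≤ |s i - s j| := by
      intro i j
      rcases le_total i j with hij | hij
      · rw [abs_sub_comm, abs_sub_comm (s i)]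
        have hij' : ((i : ℕ) : ℝ) ≤ ((j : ℕ) : ℝ) := by exact_mod_cast hij
        rw [abs_of_nonneg (by linarith)]
        exact (hs i j hij).trans (le_abs_self _)
      · have hij' : ((j : ℕ) : ℝ) ≤ ((i : ℕ) : ℝ) := by exact_mod_cast hij
        rw [abs_of_nonneg (by linarith)]
        exact (hs j i hij).trans (le_abs_self _)
    have hinj : Function.Injective s := by
      intro i j hij
      have h1 := hsep i j
      rw [hij, sub_self, abs_zero] at h1
      have h2 : |((i : ℕ) : ℝ) - ((j : ℕ) : ℝ)| = 0 :=
        le_antisymm (nonpos_of_mul_nonpos_left h1 hh) (abs_nonneg _)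
      exact Fin.ext (by exact_mod_cast sub_eq_zero.1 (abs_eq_zero.1 h2))
    have hs0 : ∀ i, 0 < s i := fun i => (hsT i).1.1
    have hs1 : ∀ i, s i ≤ 1 := fun i => (hsT i).1.2
    have hsA : ∀ i, x₀ + s i • (y - x₀) ∈ A := fun i => by
      have := (hsT i).2
      rwa [AffineMap.homothety_apply, vsub_eq_sub, vadd_eq_add, add_comm] at this
    have hbound := hF (y - x₀) (fun k => by simpa using (hyQ k).1)
      (fun k => by simpa [add_comm] using (hyQ k).2) s hinj hs0 hs1
    have hcoef := sum_norm_basis_eval_zero_le hs0 hs1 hη0 hsep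
    have hFpos : 0 < ‖F x₀‖ := by
      have h1 := (hsA 0).2
      by_contra h0
      rw [le_antisymm (not_lt.1 h0) (norm_nonneg _), mul_zero] at h1
      exact absurd h1 (not_lt.2 (norm_nonneg _))
    have hε0 : 0 ≤ ε := by positivity
    have hprod : 3 * (12 / η) ^ m * ε = 1 / 4 := by
      have h1 : 12 / η * (γ ^ 2 / (192 * d)) = 1 := by
        rw [hη]; field_simp; norm_num
      calc 3 * (12 / η) ^ m * ε = 3 * (12 / η * (γ ^ 2 / (192 * d))) ^ m / 12 := by
            rw [hε, mul_pow]; ring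
        _ = 1 / 4 := by rw [h1, one_pow]; norm_num
    have hsum : ∑ i, ‖(Lagrange.basis Finset.univ (fun i => (s i : ℂ)) i).eval 0‖ *
        ‖F (x₀ + s i • (y - x₀))‖ ≤ 1 / 4 * ‖F x₀‖ := by
      calc _ ≤ ∑ i, ‖(Lagrange.basis Finset.univ (fun i => (s i : ℂ)) i).eval 0‖ *
              (ε * ‖F x₀‖) := by
            gcongr with i
            exact (hsA i).2.le
        _ ≤ 3 * (12 / η) ^ m * (ε * ‖F x₀‖) := by rw [← Finset.sum_mul]; gcongr
        _ = 1 / 4 * ‖F x₀‖ := by rw [← mul_assoc, hprod]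
    linarith
  have hunion : volume (E ∩ Q) ≤ volume A + volume G := by
    refine (measure_mono (t := A ∪ G) fun z hz => ?_).trans (measure_union_le _ _)
    rcases lt_or_ge ‖F z‖ (ε * ‖F x₀‖) with h | h
    · exact Or.inl ⟨hz, h⟩
    · exact Or.inr ⟨hz, h⟩
  have hsplit : ENNReal.ofReal (γ / 2) * volume Q + ENNReal.ofReal (γ / 2) * volume Q
      ≤ ENNReal.ofReal (γ / 2) * volume Q + volume G := by
    rw [← add_mul, ← ENNReal.ofReal_add (by positivity) (by positivity), add_halves]
    exact hEγ.trans (hunion.trans (by gcongr))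
  exact (ENNReal.add_le_add_iff_left (ENNReal.mul_ne_top ENNReal.ofReal_ne_top hQtop)).1 hsplit

end LargeValues

/-! ### Averaging over the base point -/

section Averaging

variable {d : ℕ}

/-- Hölder's inequality for the weight `w`. -/
theorem rpow_lintegral_mul_le {α : Type*} [MeasurableSpace α] {μ : Measure α} {g w : α → ℝ≥0∞}
    (hg : Measurable g) (hw : Measurable w) {P : ℝ} (hP : 1 ≤ P) :
    (∫⁻ t, g t * w t ∂μ) ^ P ≤ (∫⁻ t, w t ∂μ) ^ (P - 1) * ∫⁻ t, g t ^ P * w t ∂μ := by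
  rcases hP.eq_or_lt with rfl | hP
  · simp
  have hP0 : 0 < P := by linarith
  have hpq := Real.HolderConjugate.conjExponent hP
  set q := P.conjExponent with hq
  have hq0 : 0 < q := hpq.symm.pos
  have h1 := ENNReal.lintegral_mul_le_Lp_mul_Lq μ hpq (f := fun t => g t * w t ^ (1 / P))
    (g := fun t => w t ^ (1 / q)) (hg.mul (hw.pow_const _)).aemeasurable
    (hw.pow_const _).aemeasurable
  have h2 : ∀ t, g t * w t ^ (1 / P) * w t ^ (1 / q) = g t * w t := fun t => by
    rw [mul_assoc, ← ENNReal.rpow_add_of_nonneg _ _ (by positivity) (by positivity),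
      one_div, one_div, hpq.inv_add_inv_eq_one, ENNReal.rpow_one]
  have h3 : ∀ t, (g t * w t ^ (1 / P)) ^ P = g t ^ P * w t := fun t => by
    rw [ENNReal.mul_rpow_of_nonneg _ _ hP0.le, ← ENNReal.rpow_mul, one_div_mul_cancel hP0.ne',
      ENNReal.rpow_one]
  have h4 : ∀ t, (w t ^ (1 / q)) ^ q = w t := fun t => by
    rw [← ENNReal.rpow_mul, one_div_mul_cancel hq0.ne', ENNReal.rpow_one]
  simp only [Pi.mul_apply, h2, h3, h4] at h1
  calc (∫⁻ t, g t * w t ∂μ) ^ P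
      ≤ ((∫⁻ t, g t ^ P * w t ∂μ) ^ (1 / P) * (∫⁻ t, w t ∂μ) ^ (1 / q)) ^ P := by gcongr
    _ = _ := by
        rw [ENNReal.mul_rpow_of_nonneg _ _ hP0.le, ← ENNReal.rpow_mul, ← ENNReal.rpow_mul,
          one_div_mul_cancel hP0.ne', ENNReal.rpow_one, mul_comm]
        congr 2
        have h5 := hpq.inv_add_inv_eq_one
        have h6 : 1 / q = 1 - P⁻¹ := by rw [one_div]; linarith
        rw [h6, sub_mul, one_mul, inv_mul_cancel₀ hP0.ne']

/-- Young's inequality for the convolution of `L^1` and `L^P`. -/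
theorem lintegral_rpow_convolution_le {g w : EuclideanSpace ℝ (Fin d) → ℝ≥0∞}
    (hg : Measurable g) (hw : Measurable w) (hw' : ∫⁻ t, w t ≠ ∞) {P : ℝ} (hP : 1 ≤ P) :
    ∫⁻ x, (∫⁻ t, g t * w (x - t)) ^ P ≤ (∫⁻ t, w t) ^ P * ∫⁻ t, g t ^ P := by
  set W := ∫⁻ t, w t with hW
  have hP0 : 0 < P := by linarith
  calc ∫⁻ x, (∫⁻ t, g t * w (x - t)) ^ P
      ≤ ∫⁻ x, W ^ (P - 1) * ∫⁻ t, g t ^ P * w (x - t) := by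
        refine lintegral_mono fun x => ?_
        have h1 := rpow_lintegral_mul_le (μ := volume) (w := fun t => w (x - t)) hg
          (hw.comp (by fun_prop)) hP
        rwa [lintegral_sub_left_eq_self w x] at h1
    _ = W ^ (P - 1) * ∫⁻ x, ∫⁻ t, g t ^ P * w (x - t) :=
        lintegral_const_mul' _ _ (ENNReal.rpow_ne_top_of_nonneg (by linarith) hw')
    _ = W ^ (P - 1) * ∫⁻ t, ∫⁻ x, g t ^ P * w (x - t) := by
        rw [lintegral_lintegral_swap]
        exact (((hg.pow_const P).comp measurable_snd).mul (hw.comp (by fun_prop))).aemeasurable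
    _ = W ^ (P - 1) * ∫⁻ t, g t ^ P * W := by
        congr 1
        refine lintegral_congr fun t => ?_
        rw [lintegral_const_mul (f := fun x => w (x - t)) _ (hw.comp (by fun_prop)),
          lintegral_sub_right_eq_self w t]
    _ = W ^ (P - 1) * (W * ∫⁻ t, g t ^ P) := by
        rw [lintegral_mul_const _ (hg.pow_const P), mul_comm W]
    _ = W ^ P * ∫⁻ t, g t ^ P := by
        rw [← mul_assoc]
        congr 1
        rcases eq_or_ne W 0 with h0 | h0
        · rw [h0, mul_zero, ENNReal.zero_rpow_of_pos hP0]
        · nth_rewrite 2 [← ENNReal.rpow_one W]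
          rw [← ENNReal.rpow_add _ _ h0 hw', sub_add_cancel]

/-- By Tonelli, as the corners of the boxes containing a given point fill a box of the same size. -/
theorem lintegral_setLIntegral_inter_axisBox (a : Fin d → ℝ)
    {E : Set (EuclideanSpace ℝ (Fin d))} (hE : MeasurableSet E)
    {G : EuclideanSpace ℝ (Fin d) → ℝ≥0∞} (hG : Measurable G) :
    ∫⁻ x, ∫⁻ y in E ∩ axisBox x a, G y = volume (axisBox 0 a) * ∫⁻ y in E, G y := by
  set I : EuclideanSpace ℝ (Fin d) → ℝ≥0∞ := (axisBox 0 a).indicator 1 with hI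
  have hIm : Measurable I := measurable_one.indicator (measurableSet_axisBox _ _)
  have h1 : ∀ x, ∫⁻ y in E ∩ axisBox x a, G y = ∫⁻ y, E.indicator G y * I (y - x) := by
    intro x
    rw [← lintegral_indicator (hE.inter (measurableSet_axisBox _ _))]
    refine lintegral_congr fun y => ?_
    have hmem : y ∈ axisBox x a ↔ y - x ∈ axisBox 0 a := by
      refine forall_congr' fun k => ?_
      simp only [PiLp.sub_apply, PiLp.zero_apply, zero_add, sub_nonneg, sub_le_iff_le_add']
    by_cases hyE : y ∈ E <;> by_cases hyQ : y - x ∈ axisBox 0 a <;>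
      simp [hI, hyE, hyQ, hmem]
  simp only [h1]
  rw [lintegral_lintegral_swap]
  · calc ∫⁻ y, ∫⁻ x, E.indicator G y * I (y - x)
        = ∫⁻ y, E.indicator G y * volume (axisBox 0 a) := by
          refine lintegral_congr fun y => ?_
          rw [lintegral_const_mul (f := fun x => I (y - x)) _ (hIm.comp (by fun_prop)),
            lintegral_sub_left_eq_self I y, hI,
            lintegral_indicator_one (measurableSet_axisBox _ _)]
      _ = _ := by
          rw [lintegral_mul_const _ (hG.indicator hE), lintegral_indicator hE, mul_comm]
  · exact (((hG.indicator hE).comp measurable_snd).mul (hIm.comp (by fun_prop))).aemeasurable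

/-- From pointwise to global lower bounds, for finite exponents: at each point `F` is either
dominated by a small multiple of its average against `w`, which is small in norm, or values at least
`ε` times as large are attained on a large part of `E` inside the box based at that point. -/
theorem mul_lintegral_rpow_le {a : Fin d → ℝ} (ha : ∀ k, 0 < a k)
    {F : EuclideanSpace ℝ (Fin d) → ℂ} (hFm : Measurable F)
    {E : Set (EuclideanSpace ℝ (Fin d))} (hE : MeasurableSet E) {w : EuclideanSpace ℝ (Fin d) → ℝ≥0∞}
    (hw : Measurable w) {Λ : ℝ≥0∞} (hΛ : ∫⁻ t, w t ≤ Λ) (hΛ0 : Λ ≠ 0) (hΛt : Λ ≠ ∞)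
    {P : ℝ} (hP : 1 ≤ P) (hFfin : ∫⁻ x, ‖F x‖ₑ ^ P ≠ ∞) {γ ε : ℝ} (hγ : 0 < γ) (hε : 0 < ε)
    (hloc : ∀ x, ∫⁻ t, ‖F t‖ₑ * w (x - t) ≤ 2 * Λ * ‖F x‖ₑ →
      ENNReal.ofReal (γ / 2) * volume (axisBox x a) ≤
        volume {y ∈ E ∩ axisBox x a | ε * ‖F x‖ ≤ ‖F y‖}) :
    ENNReal.ofReal (γ / 4) * ENNReal.ofReal ε ^ P * ∫⁻ x, ‖F x‖ₑ ^ P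
      ≤ ∫⁻ x in E, ‖F x‖ₑ ^ P := by
  have hP0 : 0 < P := by linarith
  set B : EuclideanSpace ℝ (Fin d) → ℝ≥0∞ := fun x => ∫⁻ t, ‖F t‖ₑ * w (x - t) with hB
  set q := volume (axisBox (0 : EuclideanSpace ℝ (Fin d)) a) with hq
  have hqx : ∀ x : EuclideanSpace ℝ (Fin d), volume (axisBox x a) = q := fun x => by
    rw [hq, volume_axisBox, volume_axisBox]
  have hq0 : q ≠ 0 := volume_axisBox_ne_zero _ ha
  have hqt : q ≠ ∞ := volume_axisBox_ne_top _ _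
  set D := ENNReal.ofReal (γ / 2) * ENNReal.ofReal ε ^ P * q with hD
  have hDt : D ≠ ∞ := by
    rw [hD]
    exact ENNReal.mul_ne_top (ENNReal.mul_ne_top ENNReal.ofReal_ne_top
      (ENNReal.rpow_ne_top_of_nonneg hP0.le ENNReal.ofReal_ne_top)) hqt
  have h2Λ0 : 2 * Λ ≠ 0 := mul_ne_zero two_ne_zero hΛ0
  have h2Λt : 2 * Λ ≠ ∞ := ENNReal.mul_ne_top (by finiteness) hΛt
  have hpt : ∀ x, D * ‖F x‖ₑ ^ P ≤
      (∫⁻ y in E ∩ axisBox x a, ‖F y‖ₑ ^ P) + D * ((2 * Λ)⁻¹ ^ P * B x ^ P) := by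
    intro x
    rcases le_or_gt (B x) (2 * Λ * ‖F x‖ₑ) with h | h
    · refine le_add_right ?_
      have h1 := hloc x h
      rw [hqx] at h1
      have hset : MeasurableSet {y ∈ E ∩ axisBox x a | ε * ‖F x‖ ≤ ‖F y‖} :=
        (hE.inter (measurableSet_axisBox _ _)).inter (measurableSet_le measurable_const hFm.norm)
      calc D * ‖F x‖ₑ ^ P
          = (ENNReal.ofReal (γ / 2) * q) * (ENNReal.ofReal ε * ‖F x‖ₑ) ^ P := by
            rw [hD, ENNReal.mul_rpow_of_nonneg _ _ hP0.le]; ring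
        _ ≤ volume {y ∈ E ∩ axisBox x a | ε * ‖F x‖ ≤ ‖F y‖} *
              (ENNReal.ofReal ε * ‖F x‖ₑ) ^ P := by gcongr
        _ = ∫⁻ _y in {y ∈ E ∩ axisBox x a | ε * ‖F x‖ ≤ ‖F y‖},
              (ENNReal.ofReal ε * ‖F x‖ₑ) ^ P := by rw [setLIntegral_const, mul_comm]
        _ ≤ ∫⁻ y in {y ∈ E ∩ axisBox x a | ε * ‖F x‖ ≤ ‖F y‖}, ‖F y‖ₑ ^ P := by
            refine setLIntegral_mono' hset fun y hy => ?_
            gcongr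
            rw [← ofReal_norm, ← ofReal_norm, ← ENNReal.ofReal_mul hε.le]
            exact ENNReal.ofReal_le_ofReal hy.2
        _ ≤ _ := lintegral_mono_set fun y hy => hy.1
    · refine le_add_left ?_
      gcongr
      rw [← ENNReal.mul_rpow_of_nonneg _ _ hP0.le]
      gcongr
      rw [mul_comm, ← div_eq_mul_inv, ENNReal.le_div_iff_mul_le (Or.inl h2Λ0) (Or.inl h2Λt),
        mul_comm]
      exact h.le
  have hBm : Measurable B := by
    refine Measurable.lintegral_prod_right'
      (f := fun z : EuclideanSpace ℝ (Fin d) × EuclideanSpace ℝ (Fin d) => ‖F z.2‖ₑ * w (z.1 - z.2))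
      ?_
    exact (hFm.enorm.comp measurable_snd).mul (hw.comp (by fun_prop))
  set N := ∫⁻ x, ‖F x‖ₑ ^ P with hN
  have hyoung : ∫⁻ x, B x ^ P ≤ Λ ^ P * N :=
    (lintegral_rpow_convolution_le hFm.enorm hw (ne_top_of_le_ne_top hΛt hΛ) hP).trans
      (by gcongr)
  have hmain : D * N ≤ q * (∫⁻ x in E, ‖F x‖ₑ ^ P) + D * (2⁻¹ * N) := by
    calc D * N = ∫⁻ x, D * ‖F x‖ₑ ^ P := (lintegral_const_mul' _ _ hDt).symm
      _ ≤ ∫⁻ x, ((∫⁻ y in E ∩ axisBox x a, ‖F y‖ₑ ^ P) + D * ((2 * Λ)⁻¹ ^ P * B x ^ P)) :=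
          lintegral_mono hpt
      _ = q * (∫⁻ x in E, ‖F x‖ₑ ^ P) + D * ((2 * Λ)⁻¹ ^ P * ∫⁻ x, B x ^ P) := by
          rw [lintegral_add_right _ (((hBm.pow_const P).const_mul _).const_mul _),
            lintegral_setLIntegral_inter_axisBox a hE (hFm.enorm.pow_const P),
            lintegral_const_mul _ ((hBm.pow_const P).const_mul _),
            lintegral_const_mul _ (hBm.pow_const P)]
      _ ≤ q * (∫⁻ x in E, ‖F x‖ₑ ^ P) + D * ((2 * Λ)⁻¹ ^ P * (Λ ^ P * N)) := by gcongr
      _ ≤ q * (∫⁻ x in E, ‖F x‖ₑ ^ P) + D * (2⁻¹ * N) := by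
          gcongr _ + D * ?_
          rw [← mul_assoc, ← ENNReal.mul_rpow_of_nonneg _ _ hP0.le,
            ENNReal.mul_inv (Or.inl two_ne_zero) (Or.inl (by finiteness)), mul_assoc,
            ENNReal.inv_mul_cancel hΛ0 hΛt, mul_one]
          gcongr
          exact ENNReal.rpow_le_self_of_le_one (by norm_num) hP
  have hhalf : D * (2⁻¹ * N) ≤ q * ∫⁻ x in E, ‖F x‖ₑ ^ P := by
    have h1 : D * N = D * (2⁻¹ * N) + D * (2⁻¹ * N) := by
      rw [← mul_add, ← add_mul, ENNReal.inv_two_add_inv_two, one_mul]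
    rw [h1] at hmain
    refine (ENNReal.add_le_add_iff_right ?_).1 hmain
    exact ENNReal.mul_ne_top hDt (ENNReal.mul_ne_top (by finiteness) hFfin)
  refine (ENNReal.mul_le_mul_iff_right hq0 hqt).1 (le_trans (le_of_eq ?_) hhalf)
  have h4 : ENNReal.ofReal (γ / 4) = ENNReal.ofReal (γ / 2) * 2⁻¹ := by
    rw [show γ / 4 = γ / 2 * (2 : ℝ)⁻¹ by ring, ENNReal.ofReal_mul (by positivity),
      ENNReal.ofReal_inv_of_pos two_pos, ENNReal.ofReal_ofNat]
  rw [h4, hD]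
  ring

end Averaging

/-! ### The lower bound -/

section LowerBound

variable {d : ℕ}

/-- The version for all exponents of the passage from pointwise to global lower bounds. -/
theorem mul_eLpNorm_le_of_local {p : ℝ≥0∞} (hp : 1 ≤ p) {a : Fin d → ℝ} (ha : ∀ k, 0 < a k)
    {F : EuclideanSpace ℝ (Fin d) → ℂ} (hFm : Measurable F) (hFp : eLpNorm F p volume ≠ ∞)
    {E : Set (EuclideanSpace ℝ (Fin d))} (hE : MeasurableSet E) {w : EuclideanSpace ℝ (Fin d) → ℝ≥0∞}
    (hw : Measurable w) {Λ : ℝ≥0∞} (hΛ : ∫⁻ t, w t ≤ Λ) (hΛ0 : Λ ≠ 0) (hΛt : Λ ≠ ∞)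
    {γ ε : ℝ} (hγ : 0 < γ) (hγ1 : γ ≤ 1) (hε : 0 < ε)
    (hloc : ∀ x, ∫⁻ t, ‖F t‖ₑ * w (x - t) ≤ 2 * Λ * ‖F x‖ₑ →
      ENNReal.ofReal (γ / 2) * volume (axisBox x a) ≤
        volume {y ∈ E ∩ axisBox x a | ε * ‖F x‖ ≤ ‖F y‖}) :
    ENNReal.ofReal (γ / 4 * ε) * eLpNorm F p volume ≤ eLpNorm F p (volume.restrict E) := by
  rcases eq_or_ne p ∞ with rfl | hpt
  · set N := eLpNorm F ∞ volume with hN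
    rcases eq_or_ne N 0 with h0 | h0
    · rw [h0, mul_zero]; exact zero_le
    have hle : ∀ᵐ x, ‖F x‖ₑ ≤ N := by
      rw [hN, eLpNorm_exponent_top]
      exact ae_le_eLpNormEssSup
    obtain ⟨x, hx⟩ : ∃ x, N / 2 < ‖F x‖ₑ := by
      by_contra! hall
      have h1 : N ≤ N / 2 := by
        rw [hN, eLpNorm_exponent_top]
        exact essSup_le_of_ae_le _ (Filter.Eventually.of_forall hall)
      exact absurd h1 (not_le.2 (ENNReal.half_lt_self h0 hFp))
    have hB : ∫⁻ t, ‖F t‖ₑ * w (x - t) ≤ 2 * Λ * ‖F x‖ₑ := by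
      calc ∫⁻ t, ‖F t‖ₑ * w (x - t) ≤ ∫⁻ t, N * w (x - t) := by
            refine lintegral_mono_ae ?_
            filter_upwards [hle] with t ht
            gcongr
        _ = N * ∫⁻ t, w t := by
            rw [lintegral_const_mul' _ _ hFp, lintegral_sub_left_eq_self w x]
        _ ≤ N * Λ := by gcongr
        _ = 2 * Λ * (N / 2) := by
            rw [mul_comm 2 Λ, mul_assoc, ENNReal.mul_div_cancel two_ne_zero (by finiteness),
              mul_comm]
        _ ≤ 2 * Λ * ‖F x‖ₑ := by gcongr
    have hvol := hloc x hB
    have hpos : volume {y ∈ E ∩ axisBox x a | ε * ‖F x‖ ≤ ‖F y‖} ≠ 0 := by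
      intro h
      rw [h, nonpos_iff_eq_zero, mul_eq_zero] at hvol
      rcases hvol with h1 | h1
      · rw [ENNReal.ofReal_eq_zero] at h1; linarith
      · exact volume_axisBox_ne_zero x ha h1
    have hbig : ENNReal.ofReal ε * ‖F x‖ₑ ≤ eLpNorm F ∞ (volume.restrict E) := by
      by_contra! hlt
      have hae : ∀ᵐ y ∂(volume.restrict E), ‖F y‖ₑ < ENNReal.ofReal ε * ‖F x‖ₑ := by
        have h2 : ∀ᵐ y ∂(volume.restrict E), ‖F y‖ₑ ≤ eLpNorm F ∞ (volume.restrict E) := by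
          rw [eLpNorm_exponent_top]
          exact ae_le_eLpNormEssSup
        filter_upwards [h2] with y hy using hy.trans_lt hlt
      rw [ae_restrict_iff' hE] at hae
      refine hpos (measure_mono_null (fun y hy => ?_) hae)
      simp only [Set.mem_compl_iff, Set.mem_ofPred_eq, not_forall, not_lt]
      refine ⟨hy.1.1, ?_⟩
      rw [← ofReal_norm, ← ofReal_norm, ← ENNReal.ofReal_mul hε.le]
      exact ENNReal.ofReal_le_ofReal hy.2
    refine le_trans ?_ hbig
    calc ENNReal.ofReal (γ / 4 * ε) * N ≤ ENNReal.ofReal (ε / 2) * N := by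
          gcongr
          nlinarith
      _ = ENNReal.ofReal ε * (N / 2) := by
          rw [ENNReal.ofReal_div_of_pos two_pos, ENNReal.ofReal_ofNat, ENNReal.mul_comm_div]
      _ ≤ _ := by gcongr
  · have hp0 : p ≠ 0 := (one_pos.trans_le hp).ne'
    have hP : 1 ≤ p.toReal := by
      rw [← ENNReal.toReal_one]
      exact ENNReal.toReal_mono hpt hp
    set P := p.toReal with hPdef
    have hP0 : 0 < P := by linarith
    rw [eLpNorm_eq_lintegral_rpow_enorm_toReal hp0 hpt] at hFp ⊢
    rw [eLpNorm_eq_lintegral_rpow_enorm_toReal hp0 hpt]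
    have hfin : ∫⁻ x, ‖F x‖ₑ ^ P ≠ ∞ := by
      intro h
      rw [h, ENNReal.top_rpow_of_pos (by positivity)] at hFp
      exact hFp rfl
    have h1 := mul_lintegral_rpow_le ha hFm hE hw hΛ hΛ0 hΛt hP hfin hγ hε hloc
    have h2 := ENNReal.rpow_le_rpow h1 (show 0 ≤ 1 / P by positivity)
    rw [ENNReal.mul_rpow_of_nonneg _ _ (by positivity),
      ENNReal.mul_rpow_of_nonneg _ _ (by positivity), ← ENNReal.rpow_mul,
      mul_one_div_cancel hP0.ne', ENNReal.rpow_one] at h2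
    refine le_trans ?_ h2
    rw [ENNReal.ofReal_mul (by positivity)]
    gcongr
    calc ENNReal.ofReal (γ / 4) = ENNReal.ofReal (γ / 4) ^ (1 : ℝ) := (ENNReal.rpow_one _).symm
      _ ≤ ENNReal.ofReal (γ / 4) ^ (1 / P) := by
          refine ENNReal.rpow_le_rpow_of_exponent_ge ?_ ?_
          · rw [ENNReal.ofReal_le_one]; linarith
          · rw [div_le_one hP0]; exact hP

/-- The cutoff is `1` near every point of the spectral box. The factor `2 * π` converts the angular
frequencies of `fourierSupport` to the ordinary ones of `𝓕`. -/
theorem eventually_boxCutoff_eq_one {b : Fin d → ℝ} (hb : ∀ k, 0 < b k)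
    (u : EuclideanSpace ℝ (Fin d)) {ξ : EuclideanSpace ℝ (Fin d)}
    (hξ : (2 * Real.pi) • ξ ∈ axisBox u b) :
    ∀ᶠ η in nhds ξ, boxCutoff (fun k => (u k + b k / 2) / (2 * Real.pi)) hb η = 1 := by
  have hpi := Real.pi_gt_three
  have hclose : ∀ k, |ξ k - (u k + b k / 2) / (2 * Real.pi)| < b k := by
    intro k
    have h1 := hξ k
    simp only [PiLp.smul_apply, smul_eq_mul] at h1
    have h2 : ξ k - (u k + b k / 2) / (2 * Real.pi)
        = (2 * Real.pi * ξ k - u k - b k / 2) / (2 * Real.pi) := by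
      field_simp
      ring
    rw [h2, abs_div, abs_of_pos (show (0 : ℝ) < 2 * Real.pi by positivity),
      div_lt_iff₀ (by positivity)]
    have h3 : |2 * Real.pi * ξ k - u k - b k / 2| ≤ b k / 2 := by
      rw [abs_le]; constructor <;> linarith [h1.1, h1.2]
    nlinarith [hb k]
  have hev : ∀ᶠ η : EuclideanSpace ℝ (Fin d) in nhds ξ,
      ∀ k, |η k - (u k + b k / 2) / (2 * Real.pi)| < b k := by
    rw [Filter.eventually_all]
    intro k
    have hc : Continuous fun η : EuclideanSpace ℝ (Fin d) =>
        |η k - (u k + b k / 2) / (2 * Real.pi)| := by fun_prop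
    exact hc.continuousAt.eventually_lt continuousAt_const (hclose k)
  filter_upwards [hev] with η hη
  rw [boxCutoff_apply]
  refine Finset.prod_eq_one fun k _ => ?_
  rw [cutoff_eq_one, Complex.ofReal_one]
  rw [abs_div, abs_of_pos (hb k), div_le_one (hb k)]
  exact (hη k).le

/-- The loss from the extrapolation, absorbed into the form of the final bound with the constant
`4 * C₁ + 384`. -/
theorem rpow_le_explicit_constant {C₁ γ D : ℝ} {m : ℕ} (hC₁ : 0 ≤ C₁) (hd : 1 ≤ d) (hγ0 : 0 < γ)
    (hγ1 : γ ≤ 1) (hD : 1 ≤ D) (hm : (m : ℝ) ≤ 2 * (C₁ * D + 1) + 1) :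
    (γ / (4 * C₁ + 384) ^ d) ^ ((4 * C₁ + 384) * D)
      ≤ γ / 4 * ((γ ^ 2 / (192 * d)) ^ m / 12) := by
  have hd2 : (d : ℝ) ≤ 2 ^ d := by exact_mod_cast (Nat.lt_two_pow_self (n := d)).le
  have h384 : (384 : ℝ) ≤ 384 ^ d := le_self_pow₀ (by norm_num) (by omega)
  have h192 : (192 : ℝ) * d ≤ 384 ^ d := by
    have h1 : (192 : ℝ) ≤ 192 ^ d := le_self_pow₀ (by norm_num) (by omega)
    calc (192 : ℝ) * d ≤ 192 ^ d * 2 ^ d := by gcongr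
      _ = 384 ^ d := by rw [← mul_pow]; norm_num
  have hdpos : (0 : ℝ) < d := by exact_mod_cast hd
  have hpow1 : (1 : ℝ) ≤ 384 ^ d := by linarith
  set β := γ / 384 ^ d with hβ
  have hβ0 : 0 < β := by positivity
  have hβ1 : β ≤ 1 := by
    rw [hβ, div_le_one (by positivity)]; linarith
  calc (γ / (4 * C₁ + 384) ^ d) ^ ((4 * C₁ + 384) * D)
      ≤ β ^ ((4 * C₁ + 384) * D) := by
        refine Real.rpow_le_rpow (by positivity) ?_ (by positivity)
        rw [hβ]
        gcongr
        linarith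
    _ ≤ β ^ ((2 * m + 1 : ℕ) : ℝ) := by
        refine Real.rpow_le_rpow_of_exponent_ge hβ0 hβ1 ?_
        push_cast
        nlinarith
    _ = β * (β ^ 2) ^ m := by rw [Real.rpow_natCast, pow_succ, pow_mul, mul_comm]
    _ ≤ (γ / 48) * (γ ^ 2 / (192 * d)) ^ m := by
        gcongr
        · rw [hβ]; gcongr; linarith
        · rw [hβ, div_pow]
          gcongr
          nlinarith
    _ = _ := by ring

theorem exists_rpow_mul_eLpNorm_le :
    ∃ C : ℝ, 0 < C ∧
      ∀ (d : ℕ), 1 ≤ d →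
      ∀ (p : ℝ≥0∞) [Fact (1 ≤ p)] (a b : Fin d → ℝ), (∀ k, 0 < a k) → (∀ k, 0 < b k) →
      ∀ (γ : ℝ), 0 < γ →
      ∀ (E : Set (EuclideanSpace ℝ (Fin d))), NullMeasurableSet E volume →
        MeetsAllBoxes E a γ →
      ∀ (u : EuclideanSpace ℝ (Fin d))
        (f : Lp ℂ p (volume : Measure (EuclideanSpace ℝ (Fin d)))),
        fourierSupport f ⊆ axisBox u b →
        ENNReal.ofReal ((γ / C ^ d) ^ (C * (d + ∑ k, a k * b k))) * eLpNorm f p volume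
          ≤ eLpNorm f p (volume.restrict E) := by
  obtain ⟨C₀, hC₀1, hC₀⟩ := exists_norm_cutoffKernel_le
  have hC₀0 : 0 ≤ C₀ := by linarith
  set C₁ := 38 * C₀ * Real.pi + 12 * Real.pi + 1 with hC₁
  have hC₁0 : 0 ≤ C₁ := by positivity
  refine ⟨4 * C₁ + 384, by positivity, ?_⟩
  intro d hd p _ a b ha hb γ hγ E hE hEγ u f hf
  -- Replacing `E` by a measurable subset of the same measure changes neither side.
  obtain ⟨E', hE'E, hE'm, hE'⟩ := hE.exists_measurable_subset_ae_eq
  have hE'γ : ∀ x, ENNReal.ofReal γ * volume (axisBox x a) ≤ volume (E' ∩ axisBox x a) := by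
    intro x
    rw [measure_congr (hE'.inter (Filter.EventuallyEq.refl _ (axisBox x a)))]
    exact hEγ x
  have hγ1 : γ ≤ 1 := by
    have h1 := (hE'γ 0).trans (measure_mono Set.inter_subset_right)
    rw [← ENNReal.ofReal_le_one]
    by_contra! hlt
    have h2 := ENNReal.mul_lt_mul_left (volume_axisBox_ne_zero (0 : EuclideanSpace ℝ (Fin d)) ha)
      (volume_axisBox_ne_top _ _) hlt
    rw [one_mul] at h2
    exact absurd h1 (not_le.2 h2)
  set D := (d : ℝ) + ∑ k, a k * b k with hD
  have hD1 : 1 ≤ D := by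
    have h1 : (1 : ℝ) ≤ d := by exact_mod_cast hd
    have h2 : 0 ≤ ∑ k, a k * b k := Finset.sum_nonneg fun k _ => (mul_pos (ha k) (hb k)).le
    linarith
  set c : Fin d → ℝ := fun k => (u k + b k / 2) / (2 * Real.pi) with hc
  set F : EuclideanSpace ℝ (Fin d) → ℂ := fun x => ∫ t, f t * (𝓕⁻ (boxCutoff c hb)) (x - t)
    with hF
  have hfF : f =ᵐ[volume] F := by
    refine ae_eq_integral_mul_fourierInv f (boxCutoff c hb) fun ξ hξ => ?_
    refine eventually_boxCutoff_eq_one hb u (hf ?_)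
    rw [fourierSupport, Set.mem_ofPred_eq, inv_smul_smul₀ (by positivity)]
    exact hξ
  have hFm : Measurable F := (stronglyMeasurable_integral_mul_comp_sub f _).measurable
  -- The number of nodes is chosen such that `2 ^ m` exceeds twice the mass of the majorant.
  set m : ℕ := ⌈2 * (C₁ * D + 1)⌉₊ with hm
  have hm_le : (m : ℝ) ≤ 2 * (C₁ * D + 1) + 1 := (Nat.ceil_lt_add_one (by positivity)).le
  have hm_ge : 2 * (C₁ * D + 1) ≤ m := Nat.le_ceil _
  set Λ := ENNReal.ofReal (Real.exp (C₁ * D)) with hΛ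
  have hΛm : 2 * Λ ≤ 2 ^ m := by
    have h1 : 2 * Real.exp (C₁ * D) ≤ 2 ^ m := by
      calc 2 * Real.exp (C₁ * D) ≤ Real.exp 1 * Real.exp (C₁ * D) := by
            gcongr
            linarith [Real.add_one_le_exp 1]
        _ ≤ Real.exp (m * Real.log 2) := by
            rw [← Real.exp_add]
            apply Real.exp_le_exp.2
            nlinarith [Real.log_two_gt_d9]
        _ = 2 ^ m := by
            rw [mul_comm, Real.exp_mul, Real.exp_log two_pos, Real.rpow_natCast]
    have h2 := ENNReal.ofReal_le_ofReal h1
    rwa [ENNReal.ofReal_mul (by norm_num), ENNReal.ofReal_ofNat,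
      ENNReal.ofReal_pow (by norm_num), ENNReal.ofReal_ofNat] at h2
  set w : EuclideanSpace ℝ (Fin d) → ℝ≥0∞ := fun y => ENNReal.ofReal (kernelMajorant C₀ a b y)
    with hw
  have hwm : Measurable w := (continuous_kernelMajorant C₀ a b).measurable.ennreal_ofReal
  have hwΛ : ∫⁻ t, w t ≤ Λ := by
    rw [hw, lintegral_kernelMajorant hC₀0 a hb]
    exact ENNReal.ofReal_le_ofReal (prod_kernelGrowth_mul_pi_le hC₀1 ha hb)
  have hdpos : (0 : ℝ) < d := by exact_mod_cast hd
  have hglobal := mul_eLpNorm_le_of_local (p := p) Fact.out ha hFm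
    (by rw [← eLpNorm_congr_ae hfF]; exact (Lp.memLp f).2.ne) hE'm hwm hwΛ
    (by rw [hΛ, ne_eq, ENNReal.ofReal_eq_zero, not_le]; positivity) ENNReal.ofReal_ne_top hγ hγ1
    (ε := (γ ^ 2 / (192 * d)) ^ m / 12) (by positivity) (fun x hx => by
      refine le_volume_setOf_mul_norm_le hd ha hFm (fun v hv0 hva s hs hs0 hs1 => ?_) hE'm hγ hγ1
        (hE'γ x)
      refine norm_le_sum_basis_add_half hC₀0 hC₀ f c hb hv0 hva ?_ hs hs0 hs1
      calc ∫⁻ t, ‖f t‖ₑ * ENNReal.ofReal (kernelMajorant C₀ a b (x - t))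
          = ∫⁻ t, ‖F t‖ₑ * w (x - t) := by
            refine lintegral_congr_ae ?_
            filter_upwards [hfF] with t ht
            rw [ht]
        _ ≤ 2 * Λ * ‖F x‖ₑ := hx
        _ ≤ 2 ^ m * ‖F x‖ₑ := by gcongr)
  rw [← eLpNorm_congr_ae hfF, ← eLpNorm_congr_ae (ae_restrict_of_ae hfF)] at hglobal
  refine le_trans ?_ (hglobal.trans (eLpNorm_mono_measure _ (Measure.restrict_mono hE'E le_rfl)))
  gcongr
  exact rpow_le_explicit_constant hC₁0 hd hγ hγ1 hD1 hm_le

end LowerBound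

/-! ### Periodic families of slabs -/

section Slabs

variable {d : ℕ}

theorem sum_mul_homothety (s : Fin d → ℝ) (z y : EuclideanSpace ℝ (Fin d)) (r : ℝ) :
    ∑ k, s k * AffineMap.homothety z r y k
      = r * ∑ k, s k * y k + (1 - r) * ∑ k, s k * z k := by
  rw [Finset.mul_sum, Finset.mul_sum, ← Finset.sum_add_distrib]
  refine Finset.sum_congr rfl fun k _ => ?_
  simp only [AffineMap.homothety_apply, vsub_eq_sub, vadd_eq_add, PiLp.add_apply, PiLp.smul_apply,
    PiLp.sub_apply, smul_eq_mul]
  ring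

/-- A quarter-size copy of any slab of the box fits into any slab through the middle half of the
box. The contraction is centred at a point `z` of the box, which exists because `τ` lies in that
middle half. -/
theorem volume_slab_le {a s : Fin d → ℝ} (ha : ∀ k, 0 < a k) (x : EuclideanSpace ℝ (Fin d))
    {W τ τ' δ : ℝ} (hW : W = ∑ k, s k * a k) (hW0 : 0 < W)
    (hτ : ∑ k, s k * x k + W / 4 ≤ τ) (hτ' : τ ≤ ∑ k, s k * x k + 3 * W / 4)
    (hτ'0 : ∑ k, s k * x k ≤ τ') (hτ'1 : τ' ≤ ∑ k, s k * x k + W) :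
    volume {y ∈ axisBox x a | |∑ k, s k * y k - τ'| ≤ δ}
      ≤ 4 ^ d * volume {y ∈ axisBox x a | |∑ k, s k * y k - τ| ≤ δ / 4} := by
  set r := ((4 * τ - τ') / 3 - ∑ k, s k * x k) / W with hr
  have hr0 : 0 ≤ r := div_nonneg (by linarith) hW0.le
  have hr1 : r ≤ 1 := (div_le_one hW0).2 (by linarith)
  set z : EuclideanSpace ℝ (Fin d) := x + r • WithLp.toLp 2 a with hz
  have hzQ : z ∈ axisBox x a := by
    intro k
    simp only [hz, PiLp.add_apply, PiLp.smul_apply, smul_eq_mul]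
    have := ha k
    constructor <;> nlinarith
  have hzσ : ∑ k, s k * z k = (4 * τ - τ') / 3 := by
    have h1 : ∑ k, s k * z k = ∑ k, s k * x k + r * W := by
      rw [hW, Finset.mul_sum, ← Finset.sum_add_distrib]
      refine Finset.sum_congr rfl fun k _ => ?_
      simp only [hz, PiLp.add_apply, PiLp.smul_apply, smul_eq_mul]
      ring
    rw [h1, hr, div_mul_cancel₀ _ hW0.ne']
    ring
  have hsub : AffineMap.homothety z (1 / 4 : ℝ) '' {y ∈ axisBox x a | |∑ k, s k * y k - τ'| ≤ δ}
      ⊆ {y ∈ axisBox x a | |∑ k, s k * y k - τ| ≤ δ / 4} := by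
    rintro _ ⟨y, ⟨hyQ, hy⟩, rfl⟩
    refine ⟨homothety_mem_axisBox hzQ hyQ (by norm_num) (by norm_num), ?_⟩
    rw [sum_mul_homothety, hzσ]
    have h1 : 1 / 4 * ∑ k, s k * y k + (1 - 1 / 4) * ((4 * τ - τ') / 3) - τ
        = (∑ k, s k * y k - τ') / 4 := by ring
    rw [h1, abs_div, abs_of_pos (by norm_num : (0 : ℝ) < 4)]
    linarith
  have hvol := measure_mono (μ := volume) hsub
  rw [Measure.addHaar_image_homothety, finrank_euclideanSpace_fin,
    abs_of_nonneg (by positivity)] at hvol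
  refine le_trans (le_of_eq ?_) (mul_le_mul_right hvol (4 ^ d))
  have h4 : (4 : ℝ≥0∞) ^ d * ENNReal.ofReal ((1 / 4) ^ d) = 1 := by
    rw [← ENNReal.ofReal_ofNat 4, ← ENNReal.ofReal_pow (by norm_num),
      ← ENNReal.ofReal_mul (by positivity), ← mul_pow]
    norm_num
  rw [← mul_assoc, h4, one_mul]

/-- The union of the slabs of half-width `δ / 4` around the hyperplanes `∑ k, s k * y k + θ ∈ ℤ`
meets all translates of a box across which the linear form varies by an amount between `2` and
`4`. -/
theorem meetsAllBoxes_slabs {a s : Fin d → ℝ} (ha : ∀ k, 0 < a k) (hs : ∀ k, 0 < s k)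
    (hW2 : 2 ≤ ∑ k, s k * a k) (hW4 : ∑ k, s k * a k ≤ 4) {δ γ : ℝ} (hδ0 : 0 < δ) (hδ1 : δ ≤ 1)
    (hγ0 : 0 ≤ γ) (hγ : 5 * 4 ^ d * γ ≤ δ) (θ : ℝ) :
    MeetsAllBoxes {y : EuclideanSpace ℝ (Fin d) | ∃ j : ℤ, |∑ k, s k * y k + θ - j| ≤ δ / 4}
      a γ := by
  intro x
  set W := ∑ k, s k * a k with hW
  set σx := ∑ k, s k * x k with hσx
  set Q := axisBox x a with hQ
  -- The middle half of the range of the linear form has length `W / 2 ≥ 1`, so it contains `j - θ`.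
  set j : ℤ := ⌈σx + W / 4 + θ⌉ with hj
  have hj1 : σx + W / 4 + θ ≤ j := Int.le_ceil _
  have hj2 : (j : ℝ) < σx + W / 4 + θ + 1 := Int.ceil_lt_add_one _
  set M := {y ∈ Q | |∑ k, s k * y k - (j - θ)| ≤ δ / 4} with hM
  have hMsub : M ⊆ {y : EuclideanSpace ℝ (Fin d) | ∃ j : ℤ, |∑ k, s k * y k + θ - j| ≤ δ / 4}
      ∩ Q := by
    rintro y ⟨hyQ, hy⟩
    refine ⟨⟨j, ?_⟩, hyQ⟩
    rwa [sub_sub_eq_add_sub] at hy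
  refine le_trans ?_ (measure_mono hMsub)
  set N : ℕ := ⌊W / δ⌋₊ with hN
  have hcover : Q ⊆ ⋃ i ∈ Finset.range (N + 1),
      {y ∈ Q | |∑ k, s k * y k - (σx + i * δ)| ≤ δ} := by
    intro y hy
    have hr0 : 0 ≤ ∑ k, s k * y k - σx := by
      rw [hσx, ← Finset.sum_sub_distrib]
      refine Finset.sum_nonneg fun k _ => ?_
      have := hy k
      nlinarith [hs k]
    have hr1 : ∑ k, s k * y k - σx ≤ W := by
      rw [hσx, hW, ← Finset.sum_sub_distrib]
      refine Finset.sum_le_sum fun k _ => ?_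
      have := hy k
      nlinarith [hs k]
    set r := ∑ k, s k * y k - σx with hr
    simp only [Set.mem_iUnion, Finset.mem_range, exists_prop]
    refine ⟨⌊r / δ⌋₊, Nat.lt_succ_of_le (Nat.floor_le_floor (by gcongr)), hy, ?_⟩
    have h1 : (⌊r / δ⌋₊ : ℝ) * δ ≤ r :=
      (le_div_iff₀ hδ0).1 (Nat.floor_le (div_nonneg hr0 hδ0.le))
    have h2 : r < ((⌊r / δ⌋₊ : ℝ) + 1) * δ := (div_lt_iff₀ hδ0).1 (Nat.lt_floor_add_one _)
    rw [abs_le]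
    constructor <;> linarith
  have hNle : ((N : ℝ) + 1) * δ ≤ 5 := by
    have h1 : (N : ℝ) * δ ≤ W := (le_div_iff₀ hδ0).1 (Nat.floor_le (by positivity))
    linarith
  have hvolQ : volume Q ≤ (N + 1 : ℕ) * (4 ^ d * volume M) := by
    calc volume Q ≤ ∑ i ∈ Finset.range (N + 1),
          volume {y ∈ Q | |∑ k, s k * y k - (σx + i * δ)| ≤ δ} :=
        (measure_mono hcover).trans (measure_biUnion_finset_le _ _)
      _ ≤ ∑ _i ∈ Finset.range (N + 1), 4 ^ d * volume M := by
        refine Finset.sum_le_sum fun i hi => ?_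
        have hiN : (i : ℝ) ≤ N := by exact_mod_cast Nat.lt_succ_iff.1 (Finset.mem_range.1 hi)
        have h1 : (N : ℝ) * δ ≤ W := (le_div_iff₀ hδ0).1 (Nat.floor_le (by positivity))
        exact volume_slab_le ha x hW (by linarith) (by linarith) (by linarith)
          (le_add_of_nonneg_right (by positivity)) (by nlinarith)
      _ = _ := by rw [Finset.sum_const, Finset.card_range, nsmul_eq_mul]
  calc ENNReal.ofReal γ * volume Q
      ≤ ENNReal.ofReal γ * ((N + 1 : ℕ) * (4 ^ d * volume M)) := by gcongr
    _ = ENNReal.ofReal (γ * ((N + 1) * 4 ^ d)) * volume M := by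
        rw [ENNReal.ofReal_mul hγ0, ENNReal.ofReal_mul (by positivity),
          ENNReal.ofReal_pow (by norm_num), ENNReal.ofReal_ofNat,
          show ((N : ℝ) + 1) = ((N + 1 : ℕ) : ℝ) by push_cast; rfl, ENNReal.ofReal_natCast]
        ring
    _ ≤ 1 * volume M := by
        gcongr
        rw [ENNReal.ofReal_le_one]
        have h1 : 5 * (γ * ((N + 1) * 4 ^ d)) ≤ 5 * 1 := by
          calc 5 * (γ * ((N + 1) * 4 ^ d)) = ((N : ℝ) + 1) * (5 * 4 ^ d * γ) := by ring
            _ ≤ ((N : ℝ) + 1) * δ := by gcongr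
            _ ≤ 5 * 1 := by linarith
        linarith
    _ = volume M := one_mul _

theorem measurableSet_slabs (s : Fin d → ℝ) (δ θ : ℝ) :
    MeasurableSet {y : EuclideanSpace ℝ (Fin d) | ∃ j : ℤ, |∑ k, s k * y k + θ - j| ≤ δ} := by
  rw [Set.ofPred_exists]
  refine MeasurableSet.iUnion fun j => measurableSet_le ?_ measurable_const
  fun_prop

end Slabs

/-! ### Functions with zeros of high order on hyperplanes -/

section Oscillation

variable {d : ℕ}

theorem fourierSupport_toLp_subset {p : ℝ≥0∞} [Fact (1 ≤ p)]
    {φ : 𝓢(EuclideanSpace ℝ (Fin d), ℂ)} {u : EuclideanSpace ℝ (Fin d)} {b : Fin d → ℝ}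
    (hφ : ∀ ξ, (2 * Real.pi) • ξ ∉ axisBox u b → (𝓕 φ) ξ = 0) :
    fourierSupport (φ.toLp p volume) ⊆ axisBox u b := by
  intro ω hω
  rw [fourierSupport, Set.mem_ofPred_eq, Distribution.mem_dsupport_iff] at hω
  have h1 := hω {ξ | (2 * Real.pi) • ξ ∈ axisBox u b} (fun ψ hψ => ?_)
    ((isClosed_axisBox u b).preimage (by fun_prop))
  · rwa [Set.mem_ofPred_eq, smul_inv_smul₀ (by positivity)] at h1
  · rw [Lp.toTemperedDistribution_toLp_eq, TemperedDistribution.fourier_toTemperedDistributionCLM_eq,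
      SchwartzMap.toTemperedDistributionCLM_apply_apply volume]
    refine integral_eq_zero_of_ae (Filter.Eventually.of_forall fun ξ => ?_)
    by_cases hξ : (2 * Real.pi) • ξ ∈ axisBox u b
    · have : ξ ∉ tsupport ψ := fun h => hψ h hξ
      simp [image_eq_zero_of_notMem_tsupport this]
    · simp [hφ ξ hξ]

/-- Multiplying a Schwartz function by the `n`-th power of a sine of frequency `s / 2` enlarges its
spectrum by `n s / 2` in each direction. -/
theorem exists_schwartz_sin_pow_mul (g : 𝓢(EuclideanSpace ℝ (Fin d), ℂ)) {c ρ s : Fin d → ℝ}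
    (hs : ∀ k, 0 ≤ s k) (hg : ∀ ξ, (∃ k, ρ k < |ξ k - c k|) → (𝓕 g) ξ = 0) (θ : ℝ) (n : ℕ) :
    ∃ φ : 𝓢(EuclideanSpace ℝ (Fin d), ℂ),
      (∀ x, φ x = (Real.sin (Real.pi * (∑ k, s k * x k + θ)) : ℂ) ^ n * g x) ∧
      ∀ ξ, (∃ k, ρ k + n * (s k / 2) < |ξ k - c k|) → (𝓕 φ) ξ = 0 := by
  induction n with
  | zero => exact ⟨g, fun x => by simp, fun ξ hξ => hg ξ (by simpa using hξ)⟩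
  | succ n ih =>
    obtain ⟨φ, hφ, hφs⟩ := ih
    set v : EuclideanSpace ℝ (Fin d) := WithLp.toLp 2 fun k => s k / 2 with hv
    set M : EuclideanSpace ℝ (Fin d) → 𝓢(EuclideanSpace ℝ (Fin d), ℂ) :=
      fun v => 𝓕⁻ (SchwartzMap.compSubConstCLM ℂ v (𝓕 φ)) with hM
    have hMx : ∀ v x, M v x
        = Complex.exp (((2 * Real.pi * inner ℝ v x : ℝ) : ℂ) * Complex.I) * φ x := by
      intro v x
      have h1 : ((SchwartzMap.compSubConstCLM ℂ v (𝓕 φ) : 𝓢(EuclideanSpace ℝ (Fin d), ℂ)) :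
          EuclideanSpace ℝ (Fin d) → ℂ) = fun ξ => (𝓕 φ) (ξ - v) := by ext ξ; simp
      rw [hM, SchwartzMap.fourierInv_coe, h1, fourierInv_comp_sub, ← SchwartzMap.fourierInv_coe,
        FourierTransform.fourierInv_fourier_eq]
    have hMξ : ∀ v ξ, (𝓕 (M v)) ξ = (𝓕 φ) (ξ - v) := by
      intro v ξ
      rw [hM, FourierTransform.fourier_fourierInv_eq]
      simp
    set α : ℂ := Complex.exp ((Real.pi * θ : ℝ) * Complex.I) with hα
    set β : ℂ := Complex.exp ((-(Real.pi * θ) : ℝ) * Complex.I) with hβ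
    refine ⟨(β * Complex.I / 2) • M (-v) - (α * Complex.I / 2) • M v, fun x => ?_, fun ξ hξ => ?_⟩
    · have hinner : inner ℝ v x = (∑ k, s k * x k) / 2 := by
        rw [PiLp.inner_apply, Finset.sum_div]
        refine Finset.sum_congr rfl fun k _ => ?_
        simp [hv]
        ring
      have hsin : (Real.sin (Real.pi * (∑ k, s k * x k + θ)) : ℂ)
          = (β * Complex.exp (((2 * Real.pi * inner ℝ (-v) x : ℝ) : ℂ) * Complex.I)
            - α * Complex.exp (((2 * Real.pi * inner ℝ v x : ℝ) : ℂ) * Complex.I))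
              * Complex.I / 2 := by
        rw [inner_neg_left, hinner, hα, hβ, ← Complex.exp_add, ← Complex.exp_add,
          Complex.ofReal_sin, Complex.sin]
        congr 3
        · congr 1
          push_cast
          ring
        · congr 1
          push_cast
          ring
      simp only [sub_apply, smul_apply, hMx, smul_eq_mul]
      rw [hφ, pow_succ]
      linear_combination
        (-(Real.sin (Real.pi * (∑ k, s k * x k + θ)) : ℂ) ^ n * g x) * hsin
    · obtain ⟨k, hk⟩ := hξ
      push_cast at hk
      have hsk := hs k
      have h1 : (𝓕 φ) (ξ - v) = 0 := by
        refine hφs _ ⟨k, ?_⟩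
        have h2 : (ξ - v) k - c k = (ξ k - c k) - s k / 2 := by simp [hv]; ring
        have h3 := abs_sub_abs_le_abs_sub (ξ k - c k) (s k / 2)
        rw [abs_of_nonneg (by positivity : 0 ≤ s k / 2)] at h3
        rw [h2]
        linarith
      have h2 : (𝓕 φ) (ξ - -v) = 0 := by
        refine hφs _ ⟨k, ?_⟩
        have h2 : (ξ - -v) k - c k = (ξ k - c k) - -(s k / 2) := by simp [hv]; ring
        have h3 := abs_sub_abs_le_abs_sub (ξ k - c k) (-(s k / 2))
        rw [abs_neg, abs_of_nonneg (by positivity : 0 ≤ s k / 2)] at h3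
        rw [h2]
        linarith
      rw [sub_eq_add_neg, FourierTransform.fourier_add, ← neg_smul, FourierTransform.fourier_smul,
        FourierTransform.fourier_smul]
      simp only [add_apply, smul_apply, hMξ, h1, h2, smul_zero, add_zero]

theorem eLpNorm_ne_zero_of_ne_zero {p : ℝ≥0∞} (hp : p ≠ 0)
    {g : 𝓢(EuclideanSpace ℝ (Fin d), ℂ)} (hg : g ≠ 0) : eLpNorm g p volume ≠ 0 := by
  intro h
  rw [eLpNorm_eq_zero_iff g.continuous.aestronglyMeasurable hp] at h
  refine hg (SchwartzMap.ext fun x => ?_)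
  exact congrFun (Continuous.ae_eq_iff_eq volume g.continuous continuous_zero |>.1 h) x

/-- As `|sin|` and `|cos|` are never both less than `1 / 2`, one of two shifted products is not
small in norm. -/
theorem exists_shift_le_eLpNorm {p : ℝ≥0∞} (hp : 1 ≤ p) {g : EuclideanSpace ℝ (Fin d) → ℂ}
    (hg : Continuous g) {σ : EuclideanSpace ℝ (Fin d) → ℝ} (hσ : Continuous σ) (n : ℕ) :
    ∃ θ : ℝ, ENNReal.ofReal ((1 / 2) ^ (n + 1)) * eLpNorm g p volume
      ≤ eLpNorm (fun x => (Real.sin (Real.pi * (σ x + θ)) : ℂ) ^ n * g x) p volume := by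
  by_contra! hall
  set φ : ℝ → EuclideanSpace ℝ (Fin d) → ℂ :=
    fun θ x => (Real.sin (Real.pi * (σ x + θ)) : ℂ) ^ n * g x with hφ
  have hφc : ∀ θ, Continuous (φ θ) := fun θ => by simp only [hφ]; fun_prop
  have h1 : ENNReal.ofReal ((1 / 2) ^ n) * eLpNorm g p volume
      ≤ eLpNorm (φ 0) p volume + eLpNorm (φ (1 / 2)) p volume := by
    calc ENNReal.ofReal ((1 / 2) ^ n) * eLpNorm g p volume
        = eLpNorm (fun x => ((1 / 2 : ℝ) ^ n) • g x) p volume := by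
          rw [show (fun x => ((1 / 2 : ℝ) ^ n) • g x) = ((1 / 2 : ℝ) ^ n) • g from rfl,
            eLpNorm_const_smul, Real.enorm_eq_ofReal (by positivity)]
      _ ≤ eLpNorm (fun x => ‖φ 0 x‖ + ‖φ (1 / 2) x‖) p volume := by
          refine eLpNorm_mono_real fun x => ?_
          rw [norm_smul, Real.norm_of_nonneg (by positivity)]
          simp only [hφ, norm_mul, norm_pow, Complex.norm_real, Real.norm_eq_abs, ← add_mul]
          gcongr
          rw [add_zero, mul_add, show Real.pi * (1 / 2) = Real.pi / 2 by ring, Real.sin_add_pi_div_two]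
          rcases le_or_gt (1 / 2) |Real.sin (Real.pi * σ x)| with h | h
          · exact (pow_le_pow_left₀ (by norm_num) h n).trans
              (le_add_of_nonneg_right (by positivity))
          · refine (pow_le_pow_left₀ (by norm_num) ?_ n).trans
              (le_add_of_nonneg_left (by positivity))
            by_contra! h2
            have h3 := Real.sin_sq_add_cos_sq (Real.pi * σ x)
            rw [← sq_abs, ← sq_abs (Real.cos _)] at h3
            nlinarith [abs_nonneg (Real.sin (Real.pi * σ x)), abs_nonneg (Real.cos (Real.pi * σ x))]
      _ ≤ eLpNorm (fun x => ‖φ 0 x‖) p volume + eLpNorm (fun x => ‖φ (1 / 2) x‖) p volume :=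
          eLpNorm_add_le (hφc _).norm.aestronglyMeasurable (hφc _).norm.aestronglyMeasurable hp
      _ = _ := by rw [eLpNorm_norm, eLpNorm_norm]
  refine absurd h1 (not_le.2 ((ENNReal.add_lt_add (hall 0) (hall (1 / 2))).trans_le ?_))
  rw [← add_mul, ← ENNReal.ofReal_add (by positivity) (by positivity)]
  refine le_of_eq ?_
  congr 2
  rw [pow_succ]
  ring

theorem abs_sin_pi_mul_le (t : ℝ) (j : ℤ) : |Real.sin (Real.pi * t)| ≤ Real.pi * |t - j| := by
  have h1 : |Real.sin (Real.pi * t)| = |Real.sin (Real.pi * (t - j))| := by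
    rw [mul_sub, mul_comm Real.pi (j : ℝ), Real.sin_sub_int_mul_pi, abs_mul, abs_zpow]
    simp
  rw [h1]
  refine Real.abs_sin_le_abs.trans_eq ?_
  rw [abs_mul, abs_of_pos Real.pi_pos]

end Oscillation

/-! ### Sharpness -/

theorem exists_eLpNorm_le_rpow_mul :
    ∃ c : ℝ, 0 < c ∧
      ∀ (d : ℕ), 1 ≤ d →
      ∀ (p : ℝ≥0∞) [Fact (1 ≤ p)] (a b : Fin d → ℝ), (∀ k, 0 < a k) → (∀ k, 0 < b k) →
        c⁻¹ ≤ ∑ k, a k * b k → (d : ℝ) ≤ ∑ k, a k * b k →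
      ∀ (γ : ℝ), 0 < γ → γ ≤ 1 →
      ∀ (u : EuclideanSpace ℝ (Fin d)),
      ∃ (E : Set (EuclideanSpace ℝ (Fin d)))
        (f : Lp ℂ p (volume : Measure (EuclideanSpace ℝ (Fin d)))),
        MeasurableSet E ∧ MeetsAllBoxes E a γ ∧ f ≠ 0 ∧ fourierSupport f ⊆ axisBox u b ∧
        eLpNorm f p (volume.restrict E)
          ≤ ENNReal.ofReal ((γ / c ^ d) ^ (c * (d + ∑ k, a k * b k))) * eLpNorm f p volume := by
  refine ⟨1 / 128, by norm_num, ?_⟩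
  intro d hd p _ a b ha hb hS hdS γ hγ0 hγ1 u
  set S := ∑ k, a k * b k with hSdef
  have hp1 : (1 : ℝ≥0∞) ≤ p := Fact.out
  have hp0 : p ≠ 0 := (one_pos.trans_le hp1).ne'
  have hpi3 := Real.pi_gt_three
  have hpi4 := Real.pi_lt_d2
  have hS128 : 128 ≤ S := by norm_num at hS; exact hS
  have hbb : ∀ k, 0 < b k / (16 * Real.pi) := fun k => by have := hb k; positivity
  set c : Fin d → ℝ := fun k => (u k + b k / 2) / (2 * Real.pi) with hc
  set g : 𝓢(EuclideanSpace ℝ (Fin d), ℂ) := 𝓕⁻ (boxCutoff c hbb) with hg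
  have hgF : 𝓕 g = boxCutoff c hbb := FourierTransform.fourier_fourierInv_eq _
  have hg0 : g ≠ 0 := by
    intro h
    have h1 : boxCutoff c hbb (WithLp.toLp 2 c) = 1 := by
      rw [boxCutoff_apply]
      refine Finset.prod_eq_one fun k _ => ?_
      simp [cutoff_eq_one]
    rw [← hgF, h] at h1
    have h2 : 𝓕 (0 : 𝓢(EuclideanSpace ℝ (Fin d), ℂ)) = 0 := FourierTransform.fourier_zero
    rw [h2] at h1
    simp at h1
  have hgs : ∀ ξ, (∃ k, b k / (8 * Real.pi) < |ξ k - c k|) → (𝓕 g) ξ = 0 := by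
    rintro ξ ⟨k, hk⟩
    rw [hgF, boxCutoff_apply]
    refine Finset.prod_eq_zero (Finset.mem_univ k) ?_
    rw [cutoff_eq_zero, Complex.ofReal_zero]
    rw [abs_div, abs_of_pos (hbb k), le_div_iff₀ (hbb k)]
    refine le_trans (le_of_eq ?_) hk.le
    field_simp
    ring
  have hbox : ∀ ξ : EuclideanSpace ℝ (Fin d), (2 * Real.pi) • ξ ∉ axisBox u b →
      ∃ k, b k / (4 * Real.pi) < |ξ k - c k| := by
    intro ξ hξ
    by_contra! hall
    refine hξ fun k => ?_
    have h1 := abs_le.1 (hall k)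
    have h2 : 2 * Real.pi * (ξ k - c k) = 2 * Real.pi * ξ k - u k - b k / 2 := by
      simp only [hc]; field_simp; ring
    have h3 : 2 * Real.pi * (b k / (4 * Real.pi)) = b k / 2 := by field_simp; ring
    have h4 := mul_le_mul_of_nonneg_left h1.1 (show (0 : ℝ) ≤ 2 * Real.pi by positivity)
    have h5 := mul_le_mul_of_nonneg_left h1.2 (show (0 : ℝ) ≤ 2 * Real.pi by positivity)
    simp only [PiLp.smul_apply, smul_eq_mul]
    constructor <;> linarith
  have hSd : 0 ≤ (1 / 128 : ℝ) * (d + S) := by positivity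
  -- When the base of the power is at least `1`, the bound is trivial.
  rcases le_or_gt 1 (γ / (1 / 128) ^ d) with hbig | hsmall
  · refine ⟨Set.univ, g.toLp p volume, MeasurableSet.univ, fun x => ?_, ?_, ?_, ?_⟩
    · rw [Set.univ_inter]
      exact mul_le_of_le_one_left zero_le (ENNReal.ofReal_le_one.2 hγ1)
    · intro h
      refine eLpNorm_ne_zero_of_ne_zero hp0 hg0 ?_
      rw [← eLpNorm_congr_ae (g.coeFn_toLp p volume), h]
      rw [eLpNorm_congr_ae (Lp.coeFn_zero _ _ _), eLpNorm_zero]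
    · refine fourierSupport_toLp_subset fun ξ hξ => hgs ξ ?_
      obtain ⟨k, hk⟩ := hbox ξ hξ
      refine ⟨k, lt_of_le_of_lt ?_ hk⟩
      have := (hb k).le
      gcongr
      norm_num
    · rw [Measure.restrict_univ]
      refine le_mul_of_one_le_left zero_le ?_
      rw [ENNReal.one_le_ofReal]
      exact Real.one_le_rpow hbig hSd
  -- The order of vanishing is as large as the spectral box allows.
  set n : ℕ := ⌊S / (8 * Real.pi)⌋₊ with hn
  have hn_le : (n : ℝ) * (8 * Real.pi) ≤ S :=
    (le_div_iff₀ (by positivity)).1 (Nat.floor_le (by positivity))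
  have hn_lt : S < ((n : ℝ) + 1) * (8 * Real.pi) :=
    (div_lt_iff₀ (by positivity)).1 (Nat.lt_floor_add_one _)
  have hn1 : 1 ≤ n := by
    rw [hn, Nat.le_floor_iff (by positivity), le_div_iff₀ (by positivity)]
    push_cast
    linarith
  have hn1' : (1 : ℝ) ≤ n := by exact_mod_cast hn1
  have hn_ge : S ≤ n * (16 * Real.pi) := by nlinarith
  set s : Fin d → ℝ := fun k => b k / (4 * Real.pi * n) with hs
  have hs0 : ∀ k, 0 < s k := fun k => by have := hb k; simp only [hs]; positivity
  have hW : ∑ k, s k * a k = S / (4 * Real.pi * n) := by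
    rw [hSdef, Finset.sum_div]
    refine Finset.sum_congr rfl fun k _ => ?_
    simp only [hs]
    ring
  have hW2 : 2 ≤ ∑ k, s k * a k := by
    rw [hW, le_div_iff₀ (by positivity)]; linarith
  have hW4 : ∑ k, s k * a k ≤ 4 := by
    rw [hW, div_le_iff₀ (by positivity)]; linarith
  have hγ128 : γ * 128 ^ d < 1 := by
    rw [one_div_pow, div_div_eq_mul_div, div_one] at hsmall
    exact hsmall
  set δ := 5 * 4 ^ d * γ with hδ
  have hδ0 : 0 < δ := by positivity
  have hd32 : (32 : ℝ) ≤ 32 ^ d := le_self_pow₀ (by norm_num) (by omega)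
  have hδ16 : Real.pi * δ ≤ γ * 128 ^ d := by
    calc Real.pi * δ ≤ 4 * (5 * 4 ^ d * γ) := by rw [hδ]; gcongr; linarith
      _ = γ * (20 * 4 ^ d) := by ring
      _ ≤ γ * (32 ^ d * 4 ^ d) := by gcongr; linarith
      _ = γ * 128 ^ d := by rw [← mul_pow]; norm_num
  have hδ1 : δ ≤ 1 := by nlinarith
  obtain ⟨θ, hθ⟩ := exists_shift_le_eLpNorm (p := p) hp1 g.continuous
    (σ := fun x : EuclideanSpace ℝ (Fin d) => ∑ k, s k * x k) (by fun_prop) n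
  obtain ⟨φ, hφ, hφs⟩ := exists_schwartz_sin_pow_mul g (fun k => (hs0 k).le) hgs θ n
  have hφeq : (φ : EuclideanSpace ℝ (Fin d) → ℂ)
      = fun x => (Real.sin (Real.pi * (∑ k, s k * x k + θ)) : ℂ) ^ n * g x := funext hφ
  rw [← hφeq] at hθ
  set E := {y : EuclideanSpace ℝ (Fin d) | ∃ j : ℤ, |∑ k, s k * y k + θ - j| ≤ δ / 4} with hE
  have hEm : MeasurableSet E := measurableSet_slabs s (δ / 4) θ
  refine ⟨E, φ.toLp p volume, hEm,
    meetsAllBoxes_slabs ha hs0 hW2 hW4 hδ0 hδ1 hγ0.le le_rfl θ, ?_, ?_, ?_⟩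
  · intro h
    have h1 : eLpNorm φ p volume = 0 := by
      rw [← eLpNorm_congr_ae (φ.coeFn_toLp p volume), h,
        eLpNorm_congr_ae (Lp.coeFn_zero _ _ _), eLpNorm_zero]
    rw [h1, nonpos_iff_eq_zero, mul_eq_zero, ENNReal.ofReal_eq_zero] at hθ
    rcases hθ with h2 | h2
    · exact absurd h2 (not_le.2 (by positivity))
    · exact eLpNorm_ne_zero_of_ne_zero hp0 hg0 h2
  · refine fourierSupport_toLp_subset fun ξ hξ => hφs ξ ?_
    obtain ⟨k, hk⟩ := hbox ξ hξ
    refine ⟨k, lt_of_le_of_lt (le_of_eq ?_) hk⟩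
    simp only [hs]
    field_simp
    ring
  · have hae := φ.coeFn_toLp p volume
    rw [eLpNorm_congr_ae hae, eLpNorm_congr_ae (ae_restrict_of_ae hae)]
    have hupper : eLpNorm φ p (volume.restrict E)
        ≤ ENNReal.ofReal ((Real.pi * δ / 4) ^ n) * eLpNorm g p volume := by
      refine (eLpNorm_le_nnreal_smul_eLpNorm_of_ae_le_mul (c := Real.toNNReal
        ((Real.pi * δ / 4) ^ n)) (g := g) ?_ p).trans ?_
      · rw [ae_restrict_iff' hEm]
        refine Filter.Eventually.of_forall fun y hy => ?_
        obtain ⟨j, hj⟩ := hy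
        rw [← NNReal.coe_le_coe, NNReal.coe_mul, coe_nnnorm, coe_nnnorm,
          Real.coe_toNNReal _ (by positivity), hφ, norm_mul, norm_pow, Complex.norm_real,
          Real.norm_eq_abs]
        gcongr
        refine (abs_sin_pi_mul_le _ j).trans ?_
        rw [mul_div_assoc]
        gcongr
      · rw [ENNReal.smul_def, smul_eq_mul]
        exact mul_le_mul_right (eLpNorm_mono_measure _ Measure.restrict_le_self) _
    have hconst : (Real.pi * δ / 4) ^ n
        ≤ (γ / (1 / 128) ^ d) ^ ((1 / 128 : ℝ) * (d + S)) * (1 / 2) ^ (n + 1) := by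
      have h1 : γ / (1 / 128) ^ d = γ * 128 ^ d := by
        rw [one_div_pow, div_div_eq_mul_div, div_one]
      have hexp : (1 / 128 : ℝ) * (d + S) ≤ n := by nlinarith
      calc (Real.pi * δ / 4) ^ n = (Real.pi * δ) ^ n * ((1 / 2) ^ n * (1 / 2) ^ n) := by
            rw [← mul_pow, ← mul_pow]; congr 1; ring
        _ ≤ (γ * 128 ^ d) ^ n * ((1 / 2) ^ n * (1 / 2) ^ 1) := by
            exact mul_le_mul (pow_le_pow_left₀ (by positivity) hδ16 n)
              (mul_le_mul_of_nonneg_left (pow_le_pow_of_le_one (by norm_num) (by norm_num) hn1)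
                (by positivity)) (by positivity) (by positivity)
        _ = (γ * 128 ^ d) ^ (n : ℝ) * (1 / 2) ^ (n + 1) := by
            rw [Real.rpow_natCast, pow_add]
        _ ≤ _ := by
            rw [h1]
            exact mul_le_mul_of_nonneg_right
              (Real.rpow_le_rpow_of_exponent_ge (by positivity) hγ128.le hexp) (by positivity)
    calc eLpNorm φ p (volume.restrict E)
        ≤ ENNReal.ofReal ((Real.pi * δ / 4) ^ n) * eLpNorm g p volume := hupper
      _ ≤ ENNReal.ofReal ((γ / (1 / 128) ^ d) ^ ((1 / 128 : ℝ) * (d + S)) * (1 / 2) ^ (n + 1)) *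
            eLpNorm g p volume := by gcongr
      _ = ENNReal.ofReal ((γ / (1 / 128) ^ d) ^ ((1 / 128 : ℝ) * (d + S))) *
            (ENNReal.ofReal ((1 / 2) ^ (n + 1)) * eLpNorm g p volume) := by
          rw [ENNReal.ofReal_mul (by positivity), mul_assoc]
      _ ≤ _ := by gcongr

/-- The first conjunct is the lower bound with an absolute constant `C`. The second one is its
sharpness: in the regime where `∑ a_k b_k` is bounded below by `d` and by an absolute constant, the
same expression with another absolute constant `c > 0` in place of `C` is an upper bound for some
`E` and some `f ≠ 0`. -/
theorem theorem3 :
    (∃ C : ℝ, 0 < C ∧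
      ∀ (d : ℕ), 1 ≤ d →
      ∀ (p : ℝ≥0∞) [Fact (1 ≤ p)] (a b : Fin d → ℝ), (∀ k, 0 < a k) → (∀ k, 0 < b k) →
      ∀ (γ : ℝ), 0 < γ →
      ∀ (E : Set (EuclideanSpace ℝ (Fin d))), NullMeasurableSet E volume →
        MeetsAllBoxes E a γ →
      ∀ (u : EuclideanSpace ℝ (Fin d))
        (f : Lp ℂ p (volume : Measure (EuclideanSpace ℝ (Fin d)))),
        fourierSupport f ⊆ axisBox u b →
        ENNReal.ofReal ((γ / C ^ d) ^ (C * (d + ∑ k, a k * b k))) * eLpNorm f p volume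
          ≤ eLpNorm f p (volume.restrict E)) ∧
    (∃ c : ℝ, 0 < c ∧
      ∀ (d : ℕ), 1 ≤ d →
      ∀ (p : ℝ≥0∞) [Fact (1 ≤ p)] (a b : Fin d → ℝ), (∀ k, 0 < a k) → (∀ k, 0 < b k) →
        c⁻¹ ≤ ∑ k, a k * b k → (d : ℝ) ≤ ∑ k, a k * b k →
      ∀ (γ : ℝ), 0 < γ → γ ≤ 1 →
      ∀ (u : EuclideanSpace ℝ (Fin d)),
      ∃ (E : Set (EuclideanSpace ℝ (Fin d)))
        (f : Lp ℂ p (volume : Measure (EuclideanSpace ℝ (Fin d)))),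
        MeasurableSet E ∧ MeetsAllBoxes E a γ ∧ f ≠ 0 ∧ fourierSupport f ⊆ axisBox u b ∧
        eLpNorm f p (volume.restrict E)
          ≤ ENNReal.ofReal ((γ / c ^ d) ^ (c * (d + ∑ k, a k * b k))) * eLpNorm f p volume) :=
  ⟨exists_rpow_mul_eLpNorm_le, exists_eLpNorm_le_rpow_mul⟩
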